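/- Let $\mathbb K$ be an algebraically closed field of characteristic zero, let $a\in\mathbb K\setminus\{0,-1\}$, and let $\mathfrak g=D(2,1;a)$ be the contragredient Lie superalgebra over $\mathbb K$ with Cartan matrix $\begin{pmatrix}0&1&a\\-1&2&0\\-1&0&2\end{pmatrix}$ and Chevalley generators $h_i,e_i,f_i$ ($i=1,2,3$), of which only $e_1,f_1$ are odd. Let $\mathfrak h=\sum_i\mathbb K h_i$ be its Cartan subalgebra and $\Delta=\Delta_0\sqcup\Delta_1$ its set of (even and odd) roots, $\Delta_0=\{\pm2\varepsilon_i\}$, $\Delta_1=\{\pm\varepsilon_1\pm\varepsilon_2\pm\varepsilon_3\}$, where the $\varepsilon_i$ form an orthogonal basis of $\mathfrak h^*$ for the form with $(\varepsilon_1,\varepsilon_1)=-\frac{1+a}2$, $(\varepsilon_2,\varepsilon_2)=\frac12$, $(\varepsilon_3,\varepsilon_3)=\frac a2$. The coroots $H_\alpha\in\mathfrak h$ are normalized so that $\beta(H_\alpha)=2(\alpha,\beta)/(\alpha,\alpha)$ for $\alpha\in\Delta_0$, and $\beta(H_\alpha)=-(\alpha,\beta)$ for $\alpha\in\Delta_1$,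 for all $\beta\in\mathfrak h^*$. Let $\mathbb Z[a]$ be the subring of $\mathbb K$ generated by $a$, and $\mathbb Z_a$ the subring of $\mathbb K$ generated by all $\binom{P}{n}$ with $P\in\mathbb Z[a]$ and $n\in\mathbb N$. For a subring $R\subseteq\mathbb K$, an $R$-lattice in a $\mathbb K$-vector space is the $R$-span of a $\mathbb K$-basis. Fix a Chevalley basis $\{H_1,H_2,H_3\}\cup\{X_\alpha\}_{\alpha\in\Delta}$ of $\mathfrak g$, that is, a homogeneous $\mathbb K$-basis such that: $H_1,H_2,H_3$ is a basis of $\mathfrak h$ whose $\mathbb Z[a]$-span equals the $\mathbb Z[a]$-span $\mathfrak h_{\mathbb Z[a]}$ of all coroots; $[H_i,H_j]=0$ and $[H_i,X_\alpha]=\alpha(H_i)X_\alpha$; $[X_\alpha,X_{-\alpha}]=\sigma_\alpha H_\alpha$, with $\sigma_\alpha=-1$ if $\alpha$ is a negative odd root (one of $-\varepsilon_1\pm\varepsilon_2\pm\varepsilon_3$) and $\sigma_\alpha=1$ otherwise; and, for $\alpha,\beta\in\Delta$ with $\alpha+\beta\ne0$: $[X_\alpha,X_\beta]=0$ if $\alpha+\beta\notin\Delta$,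 while if $\alpha+\beta\in\Delta$, then $[X_\alpha,X_\beta]=\pm(r+1)X_{\alpha+\beta}$ when $\alpha$ or $\beta$ is non-isotropic, $\beta-r\alpha,\dots,\beta+q\alpha$ being the $\alpha$-string through $\beta$ in $\Delta\cup\{0\}$, and $[X_\alpha,X_\beta]=\pm\beta(H_\alpha)X_{\alpha+\beta}$ when both are isotropic. The Kostant superalgebra is the unital $\mathbb Z_a$-subalgebra of the universal enveloping superalgebra $U(\mathfrak g)$ generated by $X_\alpha^n/n!$ ($\alpha\in\Delta_0$, $n\in\mathbb N$), $X_\gamma$ ($\gamma\in\Delta_1$) and $\binom Hn$ ($H\in\mathfrak h_{\mathbb Z[a]}$, $n\in\mathbb N$). Let $V$ be a finite dimensional $\mathfrak g$-module which is faithful and rational; rational means that $V$ is the direct sum of its weight spaces $V_\mu$ ($\mu\in\mathfrak h^*$) and that for every weight $\mu$ of $V$ one has $\mu(H_i)\in\mathbb Z[a]$ for $i=1,2,3$ and $\mu(H_\alpha)\in\mathbb Z$ for all $\alpha\in\Delta_0$. Let $M$ be an admissible lattice of $V$, that is, a $\mathbb Z_a$-lattice in $V$ stable under the Kostant superalgebra,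 and let $\mathfrak g_V=\{X\in\mathfrak g : X.M\subseteq M\}$. Then $$\mathfrak g_V=\mathfrak h_V\oplus\Big(\bigoplus_{\alpha\in\Delta}\mathbb Z_a X_\alpha\Big),\qquad \mathfrak h_V=\{H\in\mathfrak h : \mu(H)\in\mathbb Z_a \text{ for all weights } \mu \text{ of } V\}.$$ In particular, $\mathfrak g_V$ is a $\mathbb Z_a$-lattice in $\mathfrak g$, and it does not depend on the choice of the admissible lattice $M$ of $V$. -/

import Mathlib

open scoped Nat

noncomputable section

/-! ### Lie superalgebras, their modules and enveloping algebras -/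

/-- The sign `(-1) ^ (i * j)` of two parities. -/
def superSign (K : Type*) [Field K] (i j : ZMod 2) : K := if i = 1 ∧ j = 1 then -1 else 1

/-- A Lie superalgebra structure over `K` on the vector space `g`. -/
structure LieSuperalgebra (K g : Type*) [Field K] [AddCommGroup g] [Module K g] where
  part : ZMod 2 → Submodule K g
  isCompl : IsCompl (part 0) (part 1)
  bracket : g →ₗ[K] g →ₗ[K] g
  bracket_mem : ∀ i j : ZMod 2, ∀ x ∈ part i, ∀ y ∈ part j, bracket x y ∈ part (i + j)
  skew : ∀ i j : ZMod 2, ∀ x ∈ part i, ∀ y ∈ part j,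
    bracket x y + superSign K i j • bracket y x = 0
  jacobi : ∀ i j k : ZMod 2, ∀ x ∈ part i, ∀ y ∈ part j, ∀ z ∈ part k,
    superSign K i k • bracket x (bracket y z) + superSign K j i • bracket y (bracket z x)
      + superSign K k j • bracket z (bracket x y) = 0

namespace LieSuperalgebra

variable {K g : Type*} [Field K] [AddCommGroup g] [Module K g]

/-- A module over a Lie superalgebra: a representation on `V` in which brackets of homogeneous
elements act as supercommutators.  No grading of `V` is required; a `ℤ/2`-graded module is in
particular a module in this sense. -/
structure Rep (L : LieSuperalgebra K g) (V : Type*) [AddCommGroup V] [Module K V] where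
  toHom : g →ₗ[K] Module.End K V
  map_bracket : ∀ i j : ZMod 2, ∀ x ∈ L.part i, ∀ y ∈ L.part j,
    toHom (L.bracket x y) = toHom x * toHom y - superSign K i j • (toHom y * toHom x)

/-- The relations `x y = (-1) ^ (|x| |y|) y x + [x, y]` on the tensor algebra. -/
inductive EnvRel (L : LieSuperalgebra K g) : TensorAlgebra K g → TensorAlgebra K g → Prop
  | mk (i j : ZMod 2) (x y : g) (hx : x ∈ L.part i) (hy : y ∈ L.part j) :
      EnvRel L (TensorAlgebra.ι K x * TensorAlgebra.ι K y)
        (superSign K i j • (TensorAlgebra.ι K y * TensorAlgebra.ι K x)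
          + TensorAlgebra.ι K (L.bracket x y))

/-- The universal enveloping superalgebra `U(g)`, as an associative algebra. -/
def Env (L : LieSuperalgebra K g) : Type _ := RingQuot (EnvRel L)

instance (L : LieSuperalgebra K g) : Ring (Env L) := inferInstanceAs (Ring (RingQuot (EnvRel L)))

instance (L : LieSuperalgebra K g) : Algebra K (Env L) :=
  inferInstanceAs (Algebra K (RingQuot (EnvRel L)))

/-- The canonical map `g → U(g)`. -/
def Env.of (L : LieSuperalgebra K g) : g →ₗ[K] Env L :=
  (RingQuot.mkAlgHom K (EnvRel L)).toLinearMap ∘ₗ TensorAlgebra.ι K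

/-- The action of `U(g)` on a `g`-module. -/
def Rep.envAction {L : LieSuperalgebra K g} {V : Type*} [AddCommGroup V] [Module K V]
    (ρ : Rep L V) : Env L →ₐ[K] Module.End K V :=
  RingQuot.liftAlgHom K ⟨TensorAlgebra.lift K ρ.toHom, by
    rintro _ _ ⟨i, j, x, y, hx, hy⟩
    simp [ρ.map_bracket i j x hx y hy]⟩

theorem Rep.envAction_of {L : LieSuperalgebra K g} {V : Type*} [AddCommGroup V] [Module K V]
    (ρ : Rep L V) (x : g) : ρ.envAction (Env.of L x) = ρ.toHom x := by
  simp only [Rep.envAction, Env.of]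
  erw [RingQuot.liftAlgHom_mkAlgHom_apply]
  simp

/-- The submodule `{x ∈ g | x . M ⊆ M}`, for an `R`-submodule `M` of `V`. -/
def Rep.stabilizer {L : LieSuperalgebra K g} {V : Type*} [AddCommGroup V] [Module K V]
    (ρ : Rep L V) {R : Subring K} (M : Submodule R V) : Submodule R g where
  carrier := {x | ∀ m ∈ M, ρ.toHom x m ∈ M}
  zero_mem' := by intro m _; simp
  add_mem' := by
    intro x y hx hy m hm
    simpa using M.add_mem (hx m hm) (hy m hm)
  smul_mem' := by
    intro c x hx m hm
    have h := M.smul_mem c (hx m hm)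
    rw [Subring.smul_def] at h ⊢
    simpa using h

end LieSuperalgebra

/-- `M` is an `R`-lattice of `V`: the `R`-span of some `K`-basis `s` of `V`. -/
def IsLatticeOver {K V : Type*} [Field K] [AddCommGroup V] [Module K V] (R : Subring K)
    (M : Submodule R V) : Prop :=
  ∃ s : Set V, LinearIndepOn K id s ∧ Submodule.span K s = ⊤ ∧ M = Submodule.span R s

/-- The binomial coefficient `y (y - 1) ⋯ (y - n + 1) / n!` in a `K`-algebra. -/
def binomCoeff (K : Type*) {A : Type*} [Field K] [Ring A] [Algebra K A] (y : A) (n : ℕ) : A :=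
  ((n ! : K)⁻¹) • Polynomial.aeval y (descPochhammer K n)

/-- The divided power `y ^ n / n!` in a `K`-algebra. -/
def dividedPow (K : Type*) {A : Type*} [Field K] [Ring A] [Algebra K A] (y : A) (n : ℕ) : A :=
  ((n ! : K)⁻¹) • y ^ n

/-! ### The Lie superalgebra `D(2,1;a)` -/

namespace D21

variable {K : Type*} [Field K]

/-- The odd part `K² ⊗ K² ⊗ K²`, in coordinates. -/
abbrev Odd (K : Type*) := Fin 2 → Fin 2 → Fin 2 → K

/-- The underlying space `(sl₂ ⊕ sl₂ ⊕ sl₂) ⊕ (K² ⊗ K² ⊗ K²)` of `D(2,1;a)`. -/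
abbrev Carrier (K : Type*) [Field K] :=
  (Fin 3 → LieAlgebra.SpecialLinear.sl (Fin 2) K) × Odd K

/-- The scalars `σ = (-(1 + a) / 2, 1 / 2, a / 2)`. -/
def sigma (a : K) : Fin 3 → K := ![-(1 + a) / 2, 1 / 2, a / 2]

/-- The tensor product action of `sl₂ ⊕ sl₂ ⊕ sl₂` on `K² ⊗ K² ⊗ K²`. -/
def act (x : Fin 3 → LieAlgebra.SpecialLinear.sl (Fin 2) K) (v : Odd K) : Odd K := fun p q r =>
  ∑ t, (x 0).1 p t * v t q r + ∑ t, (x 1).1 q t * v p t r + ∑ t, (x 2).1 r t * v p q t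

/-- The symplectic form `ψ` on `K²`, on basis vectors: `ψ(e₀, e₁) = 1 = -ψ(e₁, e₀)`. -/
def psi (K : Type*) [Field K] : Matrix (Fin 2) (Fin 2) K := !![0, 1; -1, 0]

/-- The matrix `∑ c p q • P(e_p, e_q)`, where `P(u, w) ∈ sl₂` is the map
`z ↦ ψ(w, z) u + ψ(u, z) w`. -/
def symProd (c : Fin 2 → Fin 2 → K) : LieAlgebra.SpecialLinear.sl (Fin 2) K :=
  ⟨Matrix.of fun i j => ∑ p, ∑ q, c p q *
      (psi K q j * (if i = p then 1 else 0) + psi K p j * (if i = q then 1 else 0)), by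
    change Matrix.trace (n := Fin 2) (R := K) _ = 0
    simp [Matrix.trace, Fin.sum_univ_two, psi]
    ring⟩

/-- The bracket of odd elements: on pure tensors,
`[v₁ ⊗ v₂ ⊗ v₃, w₁ ⊗ w₂ ⊗ w₃] = ∑ σ i • ψ(v_j, w_j) ψ(v_k, w_k) P(v_i, w_i)`
with `{i, j, k} = {1, 2, 3}`. -/
def oddBracket (a : K) (v w : Odd K) : Fin 3 → LieAlgebra.SpecialLinear.sl (Fin 2) K :=
  ![sigma a 0 • symProd fun i j =>
      ∑ q, ∑ q', ∑ r, ∑ r', psi K q q' * psi K r r' * (v i q r * w j q' r'),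
    sigma a 1 • symProd fun i j =>
      ∑ p, ∑ p', ∑ r, ∑ r', psi K p p' * psi K r r' * (v p i r * w p' j r'),
    sigma a 2 • symProd fun i j =>
      ∑ p, ∑ p', ∑ q, ∑ q', psi K p p' * psi K q q' * (v p q i * w p' q' j)]


/-- The bracket of `sl₂ ⊕ sl₂ ⊕ sl₂`. -/
def evenBracket (x y : Fin 3 → LieAlgebra.SpecialLinear.sl (Fin 2) K) :
    Fin 3 → LieAlgebra.SpecialLinear.sl (Fin 2) K := fun i => ⁅x i, y i⁆

theorem sl_trace (x : LieAlgebra.SpecialLinear.sl (Fin 2) K) : x.1 1 1 = - x.1 0 0 := by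
  have h : Matrix.trace x.1 = 0 := x.2
  rw [Matrix.trace, Fin.sum_univ_two] at h
  simp only [Matrix.diag_apply] at h
  linear_combination h

theorem sl_ext {x y : LieAlgebra.SpecialLinear.sl (Fin 2) K} (h0 : x.1 0 0 = y.1 0 0)
    (h1 : x.1 0 1 = y.1 0 1) (h2 : x.1 1 0 = y.1 1 0) : x = y := by
  apply Subtype.ext
  ext p q
  fin_cases p <;> fin_cases q
  · exact h0
  · exact h1
  · exact h2
  · have := sl_trace x
    have := sl_trace y
    simp_all

theorem symProd_00 (c : Fin 2 → Fin 2 → K) : (symProd c).1 0 0 = -(c 0 1 + c 1 0) := by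
  simp [symProd, psi, Fin.sum_univ_two]; ring

theorem symProd_01 (c : Fin 2 → Fin 2 → K) : (symProd c).1 0 1 = 2 * c 0 0 := by
  simp [symProd, psi, Fin.sum_univ_two]; ring

theorem symProd_10 (c : Fin 2 → Fin 2 → K) : (symProd c).1 1 0 = -(2 * c 1 1) := by
  simp [symProd, psi, Fin.sum_univ_two]; ring

theorem psi_contract (f : Fin 2 → Fin 2 → Fin 2 → Fin 2 → K) :
    ∑ q, ∑ q', ∑ r, ∑ r', psi K q q' * psi K r r' * f q q' r r' =
      f 0 1 0 1 - f 0 1 1 0 - f 1 0 0 1 + f 1 0 1 0 := by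
  simp [psi, Fin.sum_univ_two]; ring

theorem oddBracket_zero (a : K) (v w : Odd K) : oddBracket a v w 0 =
    sigma a 0 • symProd fun i j => v i 0 0 * w j 1 1 - v i 0 1 * w j 1 0 - v i 1 0 * w j 0 1
      + v i 1 1 * w j 0 0 := by
  simp only [oddBracket, Matrix.cons_val]
  congr 2
  funext i j
  exact psi_contract fun q q' r r' => v i q r * w j q' r'

theorem oddBracket_one (a : K) (v w : Odd K) : oddBracket a v w 1 =
    sigma a 1 • symProd fun i j => v 0 i 0 * w 1 j 1 - v 0 i 1 * w 1 j 0 - v 1 i 0 * w 0 j 1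
      + v 1 i 1 * w 0 j 0 := by
  simp only [oddBracket, Matrix.cons_val]
  congr 2
  funext i j
  exact psi_contract fun p p' r r' => v p i r * w p' j r'

theorem oddBracket_two (a : K) (v w : Odd K) : oddBracket a v w 2 =
    sigma a 2 • symProd fun i j => v 0 0 i * w 1 1 j - v 0 1 i * w 1 0 j - v 1 0 i * w 0 1 j
      + v 1 1 i * w 0 0 j := by
  simp only [oddBracket, Matrix.cons_val]
  congr 2
  funext i j
  exact psi_contract fun p p' q q' => v p q i * w p' q' j

theorem sl_lie_apply (x y : LieAlgebra.SpecialLinear.sl (Fin 2) K) (p q : Fin 2) :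
    (⁅x, y⁆ : LieAlgebra.SpecialLinear.sl (Fin 2) K).1 p q =
      x.1 p 0 * y.1 0 q + x.1 p 1 * y.1 1 q - (y.1 p 0 * x.1 0 q + y.1 p 1 * x.1 1 q) := by
  rw [LieAlgebra.SpecialLinear.sl_bracket]
  simp [Matrix.mul_apply, Fin.sum_univ_two]

theorem sl_smul_apply (c : K) (x : LieAlgebra.SpecialLinear.sl (Fin 2) K) (p q : Fin 2) :
    (c • x).1 p q = c * x.1 p q := rfl

theorem sl_add_apply (x y : LieAlgebra.SpecialLinear.sl (Fin 2) K) (p q : Fin 2) :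
    (x + y).1 p q = x.1 p q + y.1 p q := rfl

theorem act_lie (x y : Fin 3 → LieAlgebra.SpecialLinear.sl (Fin 2) K) (w : Odd K) :
    act (evenBracket x y) w = act x (act y w) - act y (act x w) := by
  funext p q r
  simp only [act, evenBracket, sl_lie_apply, Pi.sub_apply, Fin.sum_univ_two]
  ring

theorem oddBracket_comm (a : K) (v w : Odd K) : oddBracket a v w = oddBracket a w v := by
  funext i
  fin_cases i
  · change oddBracket a v w 0 = oddBracket a w v 0
    simp only [oddBracket_zero]
    apply sl_ext <;> simp only [sl_smul_apply, symProd_00, symProd_01, symProd_10] <;> ring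
  · change oddBracket a v w 1 = oddBracket a w v 1
    simp only [oddBracket_one]
    apply sl_ext <;> simp only [sl_smul_apply, symProd_00, symProd_01, symProd_10] <;> ring
  · change oddBracket a v w 2 = oddBracket a w v 2
    simp only [oddBracket_two]
    apply sl_ext <;> simp only [sl_smul_apply, symProd_00, symProd_01, symProd_10] <;> ring

theorem lie_oddBracket (a : K) (x : Fin 3 → LieAlgebra.SpecialLinear.sl (Fin 2) K)
    (v w : Odd K) :
    evenBracket x (oddBracket a v w) = oddBracket a (act x v) w + oddBracket a v (act x w) := by
  funext i
  fin_cases i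
  · change ⁅x 0, oddBracket a v w 0⁆ = oddBracket a (act x v) w 0 + oddBracket a v (act x w) 0
    simp only [oddBracket_zero]
    apply sl_ext <;> simp only [sl_smul_apply, symProd_00, symProd_01, symProd_10, sl_lie_apply,
      sl_trace, sl_add_apply, act, Fin.sum_univ_two] <;> ring
  · change ⁅x 1, oddBracket a v w 1⁆ = oddBracket a (act x v) w 1 + oddBracket a v (act x w) 1
    simp only [oddBracket_one]
    apply sl_ext <;> simp only [sl_smul_apply, symProd_00, symProd_01, symProd_10, sl_lie_apply,
      sl_trace, sl_add_apply, act, Fin.sum_univ_two] <;> ring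
  · change ⁅x 2, oddBracket a v w 2⁆ = oddBracket a (act x v) w 2 + oddBracket a v (act x w) 2
    simp only [oddBracket_two]
    apply sl_ext <;> simp only [sl_smul_apply, symProd_00, symProd_01, symProd_10, sl_lie_apply,
      sl_trace, sl_add_apply, act, Fin.sum_univ_two] <;> ring

theorem act_oddBracket (a : K) (h2 : (2 : K) ≠ 0) (u v w : Odd K) :
    act (oddBracket a u v) w + act (oddBracket a v w) u + act (oddBracket a w u) v = 0 := by
  have h0 : sigma a 0 = - sigma a 1 - sigma a 2 := by
    simp [sigma]; field_simp; ring
  funext p q r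
  simp only [act, oddBracket_zero, oddBracket_one, oddBracket_two, Fin.sum_univ_two,
    Pi.add_apply, Pi.zero_apply, sl_smul_apply, h0]
  fin_cases p <;> fin_cases q <;> fin_cases r <;>
    simp only [Fin.zero_eta, Fin.mk_one, symProd_00, symProd_01, symProd_10, sl_trace] <;> ring

theorem act_add (x y : Fin 3 → LieAlgebra.SpecialLinear.sl (Fin 2) K) (w : Odd K) :
    act (x + y) w = act x w + act y w := by
  funext p q r
  simp only [act, Pi.add_apply, sl_add_apply, Fin.sum_univ_two]
  ring

theorem act_smul (c : K) (x : Fin 3 → LieAlgebra.SpecialLinear.sl (Fin 2) K) (w : Odd K) :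
    act (c • x) w = c • act x w := by
  funext p q r
  simp only [act, Pi.smul_apply, sl_smul_apply, Fin.sum_univ_two, smul_eq_mul]
  ring

theorem act_add' (x : Fin 3 → LieAlgebra.SpecialLinear.sl (Fin 2) K) (v w : Odd K) :
    act x (v + w) = act x v + act x w := by
  funext p q r
  simp only [act, Pi.add_apply, Fin.sum_univ_two]
  ring

theorem act_smul' (c : K) (x : Fin 3 → LieAlgebra.SpecialLinear.sl (Fin 2) K) (w : Odd K) :
    act x (c • w) = c • act x w := by
  funext p q r
  simp only [act, Pi.smul_apply, Fin.sum_univ_two, smul_eq_mul]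
  ring

theorem oddBracket_add (a : K) (u v w : Odd K) :
    oddBracket a (u + v) w = oddBracket a u w + oddBracket a v w := by
  funext i
  fin_cases i
  · change oddBracket a (u + v) w 0 = oddBracket a u w 0 + oddBracket a v w 0
    simp only [oddBracket_zero]
    apply sl_ext <;> simp only [sl_smul_apply, symProd_00, symProd_01, symProd_10,
      sl_add_apply, Pi.add_apply] <;> ring
  · change oddBracket a (u + v) w 1 = oddBracket a u w 1 + oddBracket a v w 1
    simp only [oddBracket_one]
    apply sl_ext <;> simp only [sl_smul_apply, symProd_00, symProd_01, symProd_10,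
      sl_add_apply, Pi.add_apply] <;> ring
  · change oddBracket a (u + v) w 2 = oddBracket a u w 2 + oddBracket a v w 2
    simp only [oddBracket_two]
    apply sl_ext <;> simp only [sl_smul_apply, symProd_00, symProd_01, symProd_10,
      sl_add_apply, Pi.add_apply] <;> ring

theorem oddBracket_smul (a c : K) (v w : Odd K) :
    oddBracket a (c • v) w = c • oddBracket a v w := by
  funext i
  fin_cases i
  · change oddBracket a (c • v) w 0 = c • oddBracket a v w 0
    simp only [oddBracket_zero]
    apply sl_ext <;> simp only [sl_smul_apply, symProd_00, symProd_01, symProd_10,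
      Pi.smul_apply, smul_eq_mul] <;> ring
  · change oddBracket a (c • v) w 1 = c • oddBracket a v w 1
    simp only [oddBracket_one]
    apply sl_ext <;> simp only [sl_smul_apply, symProd_00, symProd_01, symProd_10,
      Pi.smul_apply, smul_eq_mul] <;> ring
  · change oddBracket a (c • v) w 2 = c • oddBracket a v w 2
    simp only [oddBracket_two]
    apply sl_ext <;> simp only [sl_smul_apply, symProd_00, symProd_01, symProd_10,
      Pi.smul_apply, smul_eq_mul] <;> ring

theorem evenBracket_self_jacobi (x y z : Fin 3 → LieAlgebra.SpecialLinear.sl (Fin 2) K) :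
    evenBracket x (evenBracket y z) + evenBracket y (evenBracket z x)
      + evenBracket z (evenBracket x y) = 0 :=
  funext fun i => lie_jacobi (x i) (y i) (z i)

/-- The bracket `[(x, v), (y, w)] = ([x, y] + [v, w], x . w - y . v)`. -/
def bracket (a : K) : Carrier K →ₗ[K] Carrier K →ₗ[K] Carrier K :=
  LinearMap.mk₂ K
    (fun x y => (evenBracket x.1 y.1 + oddBracket a x.2 y.2, act x.1 y.2 - act y.1 x.2))
    (by
      intro x y z
      refine Prod.ext ?_ ?_
      · have h : evenBracket (x.1 + y.1) z.1 = evenBracket x.1 z.1 + evenBracket y.1 z.1 :=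
          funext fun i => add_lie _ _ _
        simp only [Prod.fst_add, Prod.snd_add, h, oddBracket_add]
        abel
      · simp only [Prod.fst_add, Prod.snd_add, act_add, act_add']
        abel)
    (by
      intro c x z
      refine Prod.ext ?_ ?_
      · have h : evenBracket (c • x.1) z.1 = c • evenBracket x.1 z.1 :=
          funext fun i => smul_lie c (x.1 i) (z.1 i)
        simp only [Prod.smul_fst, Prod.smul_snd, h, oddBracket_smul, smul_add]
      · simp only [Prod.smul_fst, Prod.smul_snd, act_smul, act_smul', smul_sub])
    (by
      intro x y z
      refine Prod.ext ?_ ?_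
      · have h : evenBracket x.1 (y.1 + z.1) = evenBracket x.1 y.1 + evenBracket x.1 z.1 :=
          funext fun i => lie_add _ _ _
        simp only [Prod.fst_add, Prod.snd_add, h, oddBracket_comm a x.2, oddBracket_add]
        abel
      · simp only [Prod.fst_add, Prod.snd_add, act_add, act_add']
        abel)
    (by
      intro c x z
      refine Prod.ext ?_ ?_
      · have h : evenBracket x.1 (c • z.1) = c • evenBracket x.1 z.1 :=
          funext fun i => lie_smul c (x.1 i) (z.1 i)
        simp only [Prod.smul_fst, Prod.smul_snd, h, oddBracket_comm a x.2, oddBracket_smul,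
          smul_add]
      · simp only [Prod.smul_fst, Prod.smul_snd, act_smul, act_smul', smul_sub])

theorem bracket_apply (a : K) (x y : Carrier K) : bracket a x y =
    (evenBracket x.1 y.1 + oddBracket a x.2 y.2, act x.1 y.2 - act y.1 x.2) := rfl

/-- The even part is `sl₂ ⊕ sl₂ ⊕ sl₂`, the odd part is `K² ⊗ K² ⊗ K²`. -/
def part (K : Type*) [Field K] (i : ZMod 2) : Submodule K (Carrier K) :=
  if i = 0 then LinearMap.ker (LinearMap.snd K _ _) else LinearMap.ker (LinearMap.fst K _ _)

theorem mem_part_zero {x : Carrier K} : x ∈ part K 0 ↔ x.2 = 0 := by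
  simp [part]

theorem mem_part_one {x : Carrier K} : x ∈ part K 1 ↔ x.1 = 0 := by
  simp [part]

theorem act_zero_left (w : Odd K) : act 0 w = 0 := by
  simpa using act_smul (0 : K) 0 w

theorem act_zero_right (x : Fin 3 → LieAlgebra.SpecialLinear.sl (Fin 2) K) :
    act x 0 = 0 := by
  simpa using act_smul' (0 : K) x 0

theorem oddBracket_zero_left (a : K) (w : Odd K) : oddBracket a 0 w = 0 := by
  simpa using oddBracket_smul a 0 0 w

theorem oddBracket_zero_right (a : K) (w : Odd K) : oddBracket a w 0 = 0 := by
  rw [oddBracket_comm, oddBracket_zero_left]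

theorem act_neg (x : Fin 3 → LieAlgebra.SpecialLinear.sl (Fin 2) K) (w : Odd K) :
    act x (-w) = -act x w := by
  simpa using act_smul' (-1 : K) x w

theorem oddBracket_neg_left (a : K) (v w : Odd K) :
    oddBracket a (-v) w = -oddBracket a v w := by
  simpa using oddBracket_smul a (-1) v w

theorem oddBracket_neg_right (a : K) (v w : Odd K) :
    oddBracket a v (-w) = -oddBracket a v w := by
  rw [oddBracket_comm, oddBracket_neg_left, oddBracket_comm]

theorem evenBracket_zero_left (x : Fin 3 → LieAlgebra.SpecialLinear.sl (Fin 2) K) :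
    evenBracket 0 x = 0 := funext fun i => zero_lie (x i)

theorem evenBracket_zero_right (x : Fin 3 → LieAlgebra.SpecialLinear.sl (Fin 2) K) :
    evenBracket x 0 = 0 := funext fun i => lie_zero (x i)

theorem evenBracket_skew (x y : Fin 3 → LieAlgebra.SpecialLinear.sl (Fin 2) K) :
    evenBracket x y + evenBracket y x = 0 := by
  funext i
  change ⁅x i, y i⁆ + ⁅y i, x i⁆ = 0
  rw [← lie_skew, neg_add_cancel]

theorem parity_cases (i : ZMod 2) : i = 0 ∨ i = 1 := by
  revert i; decide

/-- The Lie superalgebra `D(2,1;a)` over `K`. -/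
def algebra [CharZero K] (a : K) : LieSuperalgebra K (Carrier K) where
  part := part K
  isCompl := by
    constructor
    · rw [Submodule.disjoint_def]
      intro x h0 h1
      exact Prod.ext (mem_part_one.1 h1) (mem_part_zero.1 h0)
    · rw [codisjoint_iff, Submodule.eq_top_iff']
      intro x
      rw [Submodule.mem_sup]
      exact ⟨(x.1, 0), mem_part_zero.2 rfl, (0, x.2), mem_part_one.2 rfl, by simp⟩
  bracket := bracket a
  bracket_mem := by
    intro i j x hx y hy
    rcases parity_cases i with rfl | rfl <;> rcases parity_cases j with rfl | rfl
    · rw [show (0 + 0 : ZMod 2) = 0 from rfl]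
      rw [mem_part_zero] at *
      simp [bracket_apply, hx, hy, act_zero_right]
    · rw [show (0 + 1 : ZMod 2) = 1 from rfl]
      rw [mem_part_zero] at hx
      rw [mem_part_one] at *
      simp [bracket_apply, hx, hy, oddBracket_zero_left, evenBracket_zero_right]
    · rw [show (1 + 0 : ZMod 2) = 1 from rfl]
      rw [mem_part_zero] at hy
      rw [mem_part_one] at *
      simp [bracket_apply, hx, hy, oddBracket_zero_right, evenBracket_zero_left]
    · rw [show (1 + 1 : ZMod 2) = 0 from rfl]
      rw [mem_part_one] at hx hy
      rw [mem_part_zero]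
      simp [bracket_apply, hx, hy, act_zero_left]
  skew := by
    intro i j x hx y hy
    obtain ⟨x0, x1⟩ := x
    obtain ⟨y0, y1⟩ := y
    rcases parity_cases i with rfl | rfl <;> rcases parity_cases j with rfl | rfl <;>
      simp only [mem_part_zero, mem_part_one] at hx hy <;> subst hx <;> subst hy <;>
      simp [bracket_apply, superSign, evenBracket_skew, act_zero_right, act_zero_left,
        oddBracket_zero_left, oddBracket_zero_right, evenBracket_zero_right,
        evenBracket_zero_left]
    rw [oddBracket_comm, add_neg_cancel]
  jacobi := by
    have h2 : (2 : K) ≠ 0 := two_ne_zero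
    intro i j k x hx y hy z hz
    obtain ⟨x0, x1⟩ := x
    obtain ⟨y0, y1⟩ := y
    obtain ⟨z0, z1⟩ := z
    rcases parity_cases i with rfl | rfl <;> rcases parity_cases j with rfl | rfl <;>
      rcases parity_cases k with rfl | rfl <;>
      simp only [mem_part_zero, mem_part_one] at hx hy hz <;> subst hx <;> subst hy <;>
      subst hz <;>
      simp only [bracket_apply, superSign, act_zero_right, act_zero_left, oddBracket_zero_left,
        oddBracket_zero_right, evenBracket_zero_right, evenBracket_zero_left, zero_ne_one,
        and_false, and_self, if_true, if_false, one_smul, add_zero, zero_add,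
        sub_zero, zero_sub, Prod.mk_add_mk, neg_smul, Prod.mk_eq_zero, sub_self, and_true,
        true_and, act_neg, oddBracket_neg_right, Prod.neg_mk, act_lie,
        lie_oddBracket, neg_neg, neg_zero]
    · exact evenBracket_self_jacobi _ _ _
    · abel
    · abel
    · rw [oddBracket_comm a z1 (act x0 y1), oddBracket_comm a y1 (act x0 z1)]
      abel
    · abel
    · rw [oddBracket_comm a x1 (act y0 z1), oddBracket_comm a z1 (act y0 x1)]
      abel
    · rw [oddBracket_comm a y1 (act z0 x1), oddBracket_comm a x1 (act z0 y1)]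
      abel
    · rw [← act_oddBracket a h2 x1 y1 z1]
      abel

/-- The element `e` of the standard `sl₂`-triple. -/
def slE (K : Type*) [Field K] : LieAlgebra.SpecialLinear.sl (Fin 2) K :=
  ⟨!![0, 1; 0, 0], by
    change Matrix.trace (n := Fin 2) (R := K) _ = 0
    simp [Matrix.trace, Fin.sum_univ_two]⟩

/-- The element `f` of the standard `sl₂`-triple. -/
def slF (K : Type*) [Field K] : LieAlgebra.SpecialLinear.sl (Fin 2) K :=
  ⟨!![0, 0; 1, 0], by
    change Matrix.trace (n := Fin 2) (R := K) _ = 0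
    simp [Matrix.trace, Fin.sum_univ_two]⟩

/-- The element `h` of the standard `sl₂`-triple. -/
def slH (K : Type*) [Field K] : LieAlgebra.SpecialLinear.sl (Fin 2) K :=
  ⟨!![1, 0; 0, -1], by
    change Matrix.trace (n := Fin 2) (R := K) _ = 0
    simp [Matrix.trace, Fin.sum_univ_two]⟩

/-- The even element `x` in the `i`-th copy of `sl₂`. -/
def inEven (i : Fin 3) (x : LieAlgebra.SpecialLinear.sl (Fin 2) K) : Carrier K :=
  (Pi.single i x, 0)

/-- The odd basis vector `e_p ⊗ e_q ⊗ e_r`. -/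
def inOdd (K : Type*) [Field K] (p q r : Fin 2) : Carrier K :=
  (0, fun i j k => if i = p ∧ j = q ∧ k = r then 1 else 0)

/-- The Chevalley generators `h₁, h₂, h₃`. -/
def genH (a : K) : Fin 3 → Carrier K :=
  ![(1 / 2 : K) • ((1 + a) • inEven 0 (slH K) + inEven 1 (slH K) + a • inEven 2 (slH K)),
    inEven 1 (slH K), inEven 2 (slH K)]

/-- The Chevalley generators `e₁, e₂, e₃`. -/
def genE (K : Type*) [Field K] : Fin 3 → Carrier K :=
  ![inOdd K 0 1 1, inEven 1 (slE K), inEven 2 (slE K)]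

/-- The Chevalley generators `f₁, f₂, f₃`. -/
def genF (K : Type*) [Field K] : Fin 3 → Carrier K :=
  ![inOdd K 1 0 0, inEven 1 (slF K), inEven 2 (slF K)]

/-- The Cartan matrix. -/
def cartanMatrix (a : K) : Matrix (Fin 3) (Fin 3) K := !![0, 1, a; -1, 2, 0; -1, 0, 2]

theorem carrier_ext {x y : Carrier K} (h : ∀ i p q, (x.1 i).1 p q = (y.1 i).1 p q)
    (h' : ∀ p q r, x.2 p q r = y.2 p q r) : x = y :=
  Prod.ext (funext fun i => Subtype.ext (Matrix.ext (h i)))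
    (funext fun p => funext fun q => funext fun r => h' p q r)

theorem bracket_even (a : K) (i j : Fin 3) (x y : LieAlgebra.SpecialLinear.sl (Fin 2) K) :
    bracket a (inEven i x) (inEven j y) = if i = j then inEven i ⁅x, y⁆ else 0 := by
  refine Prod.ext ?_ ?_
  · funext k
    simp only [bracket_apply, inEven, oddBracket_zero_left, add_zero]
    change ⁅(Pi.single i x : Fin 3 → LieAlgebra.SpecialLinear.sl (Fin 2) K) k,
      (Pi.single j y : Fin 3 → LieAlgebra.SpecialLinear.sl (Fin 2) K) k⁆ = _
    by_cases h : i = j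
    · subst h
      rw [if_pos rfl]
      by_cases hk : k = i
      · subst hk; simp
      · simp [hk]
    · rw [if_neg h]
      by_cases hk : k = i
      · subst hk; simp [h]
      · simp [hk]
  · split_ifs <;> simp [bracket_apply, inEven, act_zero_right]

theorem inEven_smul (i : Fin 3) (c : K) (x : LieAlgebra.SpecialLinear.sl (Fin 2) K) :
    inEven i (c • x) = c • inEven i x := by
  simp [inEven, Pi.single_smul]

theorem inEven_neg (i : Fin 3) (x : LieAlgebra.SpecialLinear.sl (Fin 2) K) :
    inEven i (-x) = -inEven i x := by
  simp [inEven, Pi.single_neg]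

theorem slH_E : ⁅slH K, slE K⁆ = (2 : K) • slE K := by
  apply sl_ext <;> simp [sl_lie_apply, slH, slE]
  norm_num

theorem slH_F : ⁅slH K, slF K⁆ = -((2 : K) • slF K) := by
  rw [← neg_smul]
  apply sl_ext <;> simp [sl_lie_apply, slH, slF]
  norm_num

theorem slE_F : ⁅slE K, slF K⁆ = slH K := by
  apply sl_ext <;> simp [sl_lie_apply, slH, slE, slF]

theorem bracket_even_vec_zero (a : K) (x : LieAlgebra.SpecialLinear.sl (Fin 2) K) (v : Odd K) :
    bracket a (inEven 0 x) (0, v) =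
      (0, fun p q r => x.1 p 0 * v 0 q r + x.1 p 1 * v 1 q r) := by
  refine Prod.ext ?_ ?_
  · simp [bracket_apply, inEven, evenBracket_zero_right, oddBracket_zero_left]
  · funext i j k
    simp [bracket_apply, inEven, act]

theorem bracket_even_vec_one (a : K) (x : LieAlgebra.SpecialLinear.sl (Fin 2) K) (v : Odd K) :
    bracket a (inEven 1 x) (0, v) =
      (0, fun p q r => x.1 q 0 * v p 0 r + x.1 q 1 * v p 1 r) := by
  refine Prod.ext ?_ ?_
  · simp [bracket_apply, inEven, evenBracket_zero_right, oddBracket_zero_left]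
  · funext i j k
    simp [bracket_apply, inEven, act]

theorem bracket_even_vec_two (a : K) (x : LieAlgebra.SpecialLinear.sl (Fin 2) K) (v : Odd K) :
    bracket a (inEven 2 x) (0, v) =
      (0, fun p q r => x.1 r 0 * v p q 0 + x.1 r 1 * v p q 1) := by
  refine Prod.ext ?_ ?_
  · simp [bracket_apply, inEven, evenBracket_zero_right, oddBracket_zero_left]
  · funext i j k
    simp [bracket_apply, inEven, act]

theorem bracket_even_odd_zero (a : K) (x : LieAlgebra.SpecialLinear.sl (Fin 2) K)
    (p q r : Fin 2) : bracket a (inEven 0 x) (inOdd K p q r) =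
      x.1 0 p • inOdd K 0 q r + x.1 1 p • inOdd K 1 q r := by
  refine (bracket_even_vec_zero a x _).trans (Prod.ext (by simp [inOdd]) ?_)
  funext i j k
  fin_cases p <;> fin_cases i <;> simp [inOdd]

theorem bracket_even_odd_one (a : K) (x : LieAlgebra.SpecialLinear.sl (Fin 2) K)
    (p q r : Fin 2) : bracket a (inEven 1 x) (inOdd K p q r) =
      x.1 0 q • inOdd K p 0 r + x.1 1 q • inOdd K p 1 r := by
  refine (bracket_even_vec_one a x _).trans (Prod.ext (by simp [inOdd]) ?_)
  funext i j k
  fin_cases q <;> fin_cases j <;> simp [inOdd]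

theorem bracket_even_odd_two (a : K) (x : LieAlgebra.SpecialLinear.sl (Fin 2) K)
    (p q r : Fin 2) : bracket a (inEven 2 x) (inOdd K p q r) =
      x.1 0 r • inOdd K p q 0 + x.1 1 r • inOdd K p q 1 := by
  refine (bracket_even_vec_two a x _).trans (Prod.ext (by simp [inOdd]) ?_)
  funext i j k
  fin_cases r <;> fin_cases k <;> simp [inOdd]

theorem bracket_odd_even (a : K) (i : Fin 3) (x : LieAlgebra.SpecialLinear.sl (Fin 2) K)
    (p q r : Fin 2) : bracket a (inOdd K p q r) (inEven i x) =
      -bracket a (inEven i x) (inOdd K p q r) := by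
  simp [bracket_apply, inEven, inOdd, evenBracket_zero_right, evenBracket_zero_left,
    oddBracket_zero_left, oddBracket_zero_right, act_zero_left]

theorem bracket_odd (a : K) (p q r p' q' r' : Fin 2) :
    bracket a (inOdd K p q r) (inOdd K p' q' r') =
      inEven 0 ((sigma a 0 * psi K q q' * psi K r r') •
          symProd (fun i j => if i = p ∧ j = p' then 1 else 0))
      + inEven 1 ((sigma a 1 * psi K p p' * psi K r r') •
          symProd (fun i j => if i = q ∧ j = q' then 1 else 0))
      + inEven 2 ((sigma a 2 * psi K p p' * psi K q q') •
          symProd (fun i j => if i = r ∧ j = r' then 1 else 0)) := by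
  have key : ∀ (c d : K) (f g : Fin 2 → Fin 2 → K), (∀ i j, f i j = d * g i j) →
      c • symProd f = (c * d) • symProd g := by
    intro c d f g h
    apply sl_ext <;> simp only [sl_smul_apply, symProd_00, symProd_01, symProd_10, h] <;> ring
  refine Prod.ext ?_ ?_
  · funext k
    fin_cases k
    · simp only [bracket_apply, inEven, inOdd, evenBracket_zero_left, zero_add,
        Fin.zero_eta, Prod.fst_add, Pi.add_apply, Pi.single_eq_same]
      rw [oddBracket_zero, mul_assoc (sigma a 0), Pi.single_eq_of_ne (by decide),
        Pi.single_eq_of_ne (by decide), add_zero, add_zero]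
      apply key
      intro i j
      fin_cases q <;> fin_cases q' <;> fin_cases r <;> fin_cases r' <;> simp [psi, ite_and] <;>
        split_ifs <;> simp
    · simp only [bracket_apply, inEven, inOdd, evenBracket_zero_left, zero_add,
        Fin.mk_one, Prod.fst_add, Pi.add_apply, Pi.single_eq_same]
      rw [oddBracket_one, mul_assoc (sigma a 1), Pi.single_eq_of_ne (by decide),
        Pi.single_eq_of_ne (by decide), add_zero, zero_add]
      apply key
      intro i j
      fin_cases p <;> fin_cases p' <;> fin_cases r <;> fin_cases r' <;> simp [psi, ite_and] <;>
        split_ifs <;> simp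
    · simp only [bracket_apply, inEven, inOdd, evenBracket_zero_left, zero_add,
        Fin.reduceFinMk, Prod.fst_add, Pi.add_apply, Pi.single_eq_same]
      rw [oddBracket_two, mul_assoc (sigma a 2), Pi.single_eq_of_ne (by decide),
        Pi.single_eq_of_ne (by decide), zero_add, zero_add]
      apply key
      intro i j
      fin_cases p <;> fin_cases p' <;> fin_cases q <;> fin_cases q' <;> simp [psi, ite_and] <;>
        split_ifs <;> simp
  · simp [bracket_apply, inEven, inOdd, act_zero_left]


theorem symProd_h : symProd (fun i j : Fin 2 => if i = 0 ∧ j = 1 then (1 : K) else 0) = -slH K ∧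
    symProd (fun i j : Fin 2 => if i = 1 ∧ j = 0 then (1 : K) else 0) = -slH K := by
  constructor <;> rw [← neg_one_smul K] <;> apply sl_ext <;>
    simp [symProd_00, symProd_01, symProd_10, slH]

theorem symProd_e : symProd (fun i j : Fin 2 => if i = 0 ∧ j = 0 then (1 : K) else 0) =
    (2 : K) • slE K := by
  apply sl_ext <;> simp [symProd_00, symProd_01, symProd_10, slE]

theorem symProd_f : symProd (fun i j : Fin 2 => if i = 1 ∧ j = 1 then (1 : K) else 0) =
    -((2 : K) • slF K) := by
  rw [← neg_smul]
  apply sl_ext <;> simp [symProd_00, symProd_01, symProd_10, slF]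

set_option maxHeartbeats 1000000 in
/-- The defining relations of the contragredient Lie superalgebra with the Cartan matrix above. -/
theorem gen_relations [CharZero K] (a : K) (i j : Fin 3) :
    bracket a (genH a i) (genH a j) = 0 ∧
    bracket a (genH a i) (genE K j) = cartanMatrix a i j • genE K j ∧
    bracket a (genH a i) (genF K j) = -(cartanMatrix a i j • genF K j) ∧
    bracket a (genE K i) (genF K j) = (if i = j then genH a i else 0) ∧
    bracket a (genE K 0) (genE K 0) = 0 ∧ bracket a (genF K 0) (genF K 0) = 0 := by
  have h2 : (2 : K) ≠ 0 := two_ne_zero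
  refine ⟨?_, ?_, ?_, ?_, ?_, ?_⟩
  · fin_cases i <;> fin_cases j <;> simp [genH, bracket_even] <;> simp [inEven]
  · fin_cases i <;> fin_cases j <;>
      simp [genH, genE, cartanMatrix, bracket_even, bracket_even_odd_zero, bracket_even_odd_one,
        bracket_even_odd_two, slH_E, inEven_smul] <;> try simp [slH]
    all_goals try module
  · fin_cases i <;> fin_cases j <;>
      simp [genH, genF, cartanMatrix, bracket_even, bracket_even_odd_zero, bracket_even_odd_one,
        bracket_even_odd_two, slH_F, inEven_neg, inEven_smul] <;> try simp [slH]
    all_goals try module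
  · fin_cases i <;> fin_cases j <;>
      simp [genH, genF, genE, bracket_even, bracket_even_odd_one, bracket_even_odd_two, slE_F,
        bracket_odd_even, bracket_odd]
    · simp only [psi, symProd_h, sigma, inEven_smul, inEven_neg, smul_neg, Matrix.cons_val]
      simp
      module
    all_goals simp [slE, slF]
  · simp [genE, bracket_odd, psi, inEven]
  · simp [genF, bracket_odd, psi, inEven]


theorem mem_of_basis (S : Submodule K (Carrier K)) (hE : ∀ i, inEven i (slE K) ∈ S)
    (hF : ∀ i, inEven i (slF K) ∈ S) (hH : ∀ i, inEven i (slH K) ∈ S)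
    (hO : ∀ p q r, inOdd K p q r ∈ S) (x : Carrier K) : x ∈ S := by
  have h : x = ∑ i, ((x.1 i).1 0 1 • inEven i (slE K) + (x.1 i).1 1 0 • inEven i (slF K)
      + (x.1 i).1 0 0 • inEven i (slH K)) + ∑ p, ∑ q, ∑ r, x.2 p q r • inOdd K p q r := by
    refine Prod.ext ?_ ?_
    · have hx : ∀ y : LieAlgebra.SpecialLinear.sl (Fin 2) K,
          y.1 0 1 • slE K + y.1 1 0 • slF K + y.1 0 0 • slH K = y := by
        intro y
        apply sl_ext <;> simp [slE, slF, slH]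
      funext i
      conv_lhs => rw [← hx (x.1 i)]
      fin_cases i <;> simp [Fin.sum_univ_three, inEven, inOdd]
    · funext p q r
      fin_cases p <;> fin_cases q <;> fin_cases r <;>
        simp [Fin.sum_univ_three, inEven, inOdd]
  rw [h]
  refine S.add_mem (S.sum_mem fun i _ => S.add_mem (S.add_mem (S.smul_mem _ (hE i))
    (S.smul_mem _ (hF i))) (S.smul_mem _ (hH i))) ?_
  exact S.sum_mem fun p _ => S.sum_mem fun q _ => S.sum_mem fun r _ => S.smul_mem _ (hO p q r)

/-- `D(2,1;a)` is generated by the Chevalley generators. -/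
theorem gen_generate [CharZero K] {a : K} (ha : a ≠ -1) (S : Submodule K (Carrier K))
    (hS : ∀ x ∈ S, ∀ y ∈ S, bracket a x y ∈ S) (hE : ∀ i, genE K i ∈ S)
    (hF : ∀ i, genF K i ∈ S) : S = ⊤ := by
  have h2 : (2 : K) ≠ 0 := two_ne_zero
  have ha1 : 1 + a ≠ 0 := fun h => ha (by linear_combination h)
  have e1 : inOdd K 0 1 1 ∈ S := hE 0
  have e2 : inEven 1 (slE K) ∈ S := hE 1
  have e3 : inEven 2 (slE K) ∈ S := hE 2
  have f1 : inOdd K 1 0 0 ∈ S := hF 0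
  have f2 : inEven 1 (slF K) ∈ S := hF 1
  have f3 : inEven 2 (slF K) ∈ S := hF 2
  have o001 : inOdd K 0 0 1 ∈ S := by
    simpa [bracket_even_odd_one, slE] using hS _ e2 _ e1
  have o010 : inOdd K 0 1 0 ∈ S := by
    simpa [bracket_even_odd_two, slE] using hS _ e3 _ e1
  have o000 : inOdd K 0 0 0 ∈ S := by
    simpa [bracket_even_odd_one, slE] using hS _ e2 _ o010
  have o110 : inOdd K 1 1 0 ∈ S := by
    simpa [bracket_even_odd_one, slF] using hS _ f2 _ f1
  have o101 : inOdd K 1 0 1 ∈ S := by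
    simpa [bracket_even_odd_two, slF] using hS _ f3 _ f1
  have o111 : inOdd K 1 1 1 ∈ S := by
    simpa [bracket_even_odd_one, slF] using hS _ f2 _ o101
  have e0 : inEven 0 (slE K) ∈ S := by
    have h := hS _ o000 _ e1
    rw [bracket_odd, symProd_e] at h
    rw [← S.smul_mem_iff (neg_ne_zero.2 ha1)]
    convert h using 1
    simp [psi, sigma, inEven, smul_smul, ← Pi.single_smul]
  have f0 : inEven 0 (slF K) ∈ S := by
    have h := hS _ o111 _ f1
    rw [bracket_odd, symProd_f] at h
    rw [← S.smul_mem_iff ha1]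
    convert h using 1
    simp [psi, sigma, inEven, smul_smul, ← Pi.single_smul, ← neg_smul]
  have hEE : ∀ i, inEven i (slE K) ∈ S := by
    intro i
    fin_cases i
    exacts [e0, e2, e3]
  have hFF : ∀ i, inEven i (slF K) ∈ S := by
    intro i
    fin_cases i
    exacts [f0, f2, f3]
  rw [Submodule.eq_top_iff']
  refine mem_of_basis S hEE hFF (fun i => ?_) (fun p q r => ?_)
  · simpa [bracket_even, slE_F] using hS _ (hEE i) _ (hFF i)
  · fin_cases p <;> fin_cases q <;> fin_cases r <;> assumption

/-- The Cartan subalgebra `h`, spanned by the diagonal elements of the three copies of `sl₂`. -/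
def cartan (K : Type*) [Field K] : Submodule K (Carrier K) :=
  Submodule.span K (Set.range fun i => inEven i (slH K))

/-- `h` is spanned by `h₁, h₂, h₃`. -/
theorem cartan_eq [CharZero K] {a : K} (ha : a ≠ -1) :
    cartan K = Submodule.span K (Set.range (genH a)) := by
  have ha1 : 1 + a ≠ 0 := fun h => ha (by linear_combination h)
  have m : ∀ i, inEven i (slH K) ∈ cartan K := fun i => Submodule.subset_span ⟨i, rfl⟩
  apply le_antisymm
  · rw [cartan, Submodule.span_le]
    have n : ∀ i, genH a i ∈ Submodule.span K (Set.range (genH a)) :=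
      fun i => Submodule.subset_span ⟨i, rfl⟩
    have n1 : inEven 1 (slH K) ∈ Submodule.span K (Set.range (genH a)) := n 1
    have n2 : inEven 2 (slH K) ∈ Submodule.span K (Set.range (genH a)) := n 2
    rintro _ ⟨i, rfl⟩
    fin_cases i
    · have h := Submodule.sub_mem _ (Submodule.sub_mem _ (Submodule.smul_mem _ (2 : K) (n 0)) n1)
        (Submodule.smul_mem _ a n2)
      have h' : (1 + a) • inEven 0 (slH K) ∈ Submodule.span K (Set.range (genH a)) := by
        convert h using 1
        simp only [genH, Matrix.cons_val]
        module
      exact (Submodule.smul_mem_iff _ ha1).1 h'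
    · exact n1
    · exact n2
  · rw [Submodule.span_le]
    rintro _ ⟨i, rfl⟩
    fin_cases i
    · exact Submodule.smul_mem _ _ (Submodule.add_mem _ (Submodule.add_mem _
        (Submodule.smul_mem _ _ (m 0)) (m 1)) (Submodule.smul_mem _ _ (m 2)))
    · exact m 1
    · exact m 2

theorem bracket_proj (a : K) (v : Odd K) (s : Fin 2) (i : Fin 3) :
    ∃ x y : Carrier K, bracket a x (bracket a y (0, v)) =
      (0, fun p q r => if ![p, q, r] i = s then v p q r else 0) := by
  refine ⟨inEven i (![slE K, slF K] s), inEven i (![slF K, slE K] s), ?_⟩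
  fin_cases i
  · refine (congrArg _ (bracket_even_vec_zero a _ v)).trans ((bracket_even_vec_zero a _ _).trans ?_)
    refine Prod.ext rfl ?_
    funext p q r
    fin_cases s <;> fin_cases p <;> simp [slE, slF]
  · refine (congrArg _ (bracket_even_vec_one a _ v)).trans ((bracket_even_vec_one a _ _).trans ?_)
    refine Prod.ext rfl ?_
    funext p q r
    fin_cases s <;> fin_cases q <;> simp [slE, slF]
  · refine (congrArg _ (bracket_even_vec_two a _ v)).trans ((bracket_even_vec_two a _ _).trans ?_)
    refine Prod.ext rfl ?_
    funext p q r
    fin_cases s <;> fin_cases r <;> simp [slE, slF]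

/-- A homogeneous ideal of `D(2,1;a)` that meets `h` trivially is zero. -/
theorem ideal_eq_bot [CharZero K] (a : K) (I : Submodule K (Carrier K))
    (hI : ∀ x, ∀ y ∈ I, bracket a x y ∈ I) (hg : ∀ y ∈ I, ((y.1, 0) : Carrier K) ∈ I)
    (hc : I ⊓ cartan K = ⊥) : I = ⊥ := by
  have h2 : (2 : K) ≠ 0 := two_ne_zero
  have hodd : ∀ v : Odd K, ((0, v) : Carrier K) ∈ I → v = 0 := by
    intro v hv
    by_contra hne
    have hex : ∃ p q r, v p q r ≠ 0 := by
      by_contra hno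
      push Not at hno
      exact hne (funext fun p => funext fun q => funext fun r => hno p q r)
    obtain ⟨p, q, r, hpqr⟩ := hex
    obtain ⟨x0, y0, h0⟩ := bracket_proj a v p 0
    have m0 := hI x0 _ (hI y0 _ hv)
    rw [h0] at m0
    obtain ⟨x1, y1, h1⟩ := bracket_proj a (fun i j k => if ![i, j, k] 0 = p then v i j k else 0) q 1
    have m1 := hI x1 _ (hI y1 _ m0)
    rw [h1] at m1
    obtain ⟨x2, y2, h2⟩ := bracket_proj a (fun i j k => if ![i, j, k] 1 = q then
      (if ![i, j, k] 0 = p then v i j k else 0) else 0) r 2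
    have m2 := hI x2 _ (hI y2 _ m1)
    rw [h2] at m2
    have m3 : inOdd K p q r ∈ I := by
      rw [← I.smul_mem_iff hpqr]
      convert m2 using 1
      refine Prod.ext (by simp [inOdd]) ?_
      funext i j k
      simp only [inOdd, Prod.smul_mk, Pi.smul_apply, Matrix.cons_val, smul_eq_mul]
      by_cases hi : i = p <;> by_cases hj : j = q <;> by_cases hk : k = r <;> simp [hi, hj, hk]
    have hs : ∀ p : Fin 2, ∃ c : K, symProd (fun i j => if i = 1 - p ∧ j = p then (1 : K) else 0)
        = c • slH K ∧ c ≠ 0 := by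
      intro p
      refine ⟨-1, ?_, by simp⟩
      fin_cases p
      · simpa using (symProd_h (K := K)).2
      · simpa using (symProd_h (K := K)).1
    obtain ⟨c0, hc0, -⟩ := hs p
    obtain ⟨c1, hc1, hc1'⟩ := hs q
    obtain ⟨c2, hc2, -⟩ := hs r
    have m4 := hI (inOdd K (1 - p) (1 - q) (1 - r)) _ m3
    have m5 := m4
    rw [bracket_odd, hc0, hc1, hc2] at m5
    simp only [smul_smul, inEven_smul] at m5
    have m6 : _ ∈ cartan K := Submodule.add_mem _ (Submodule.add_mem _
      (Submodule.smul_mem _ (sigma a 0 * psi K (1 - q) q * psi K (1 - r) r * c0)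
        (Submodule.subset_span ⟨0, rfl⟩))
      (Submodule.smul_mem _ (sigma a 1 * psi K (1 - p) p * psi K (1 - r) r * c1)
        (Submodule.subset_span ⟨1, rfl⟩)))
      (Submodule.smul_mem _ (sigma a 2 * psi K (1 - p) p * psi K (1 - q) q * c2)
        (Submodule.subset_span ⟨2, rfl⟩))
    have m7 := Submodule.mem_inf.2 ⟨m5, m6⟩
    rw [hc, Submodule.mem_bot] at m7
    have m8 := congrArg (fun x : Carrier K => (x.1 1).1 0 0) m7
    have hp : ∀ p : Fin 2, psi K (1 - p) p ≠ 0 := by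
      intro p
      fin_cases p <;> simp [psi]
    simp [inEven, slH, sigma, hc1', hp] at m8
  rw [Submodule.eq_bot_iff]
  intro y hy
  have hy1 := hg y hy
  have hy2 : y.2 = 0 := by
    apply hodd
    have h := I.sub_mem hy hy1
    convert h using 1
    simp [Prod.ext_iff]
  have hz : ∀ p q r i j k, act y.1 (inOdd K p q r).2 i j k = 0 := by
    intro p q r i j k
    have h : act y.1 (inOdd K p q r).2 = 0 := by
      apply hodd
      have h := I.neg_mem (hI (inOdd K p q r) _ hy1)
      convert h using 1
      simp [bracket_apply, inOdd, evenBracket_zero_left, oddBracket_zero_right, act_zero_left]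
    rw [h]
    rfl
  refine carrier_ext (fun i p q => ?_) (fun p q r => by simp [hy2])
  have a1 := hz 0 0 0 0 0 0
  have a2 := hz 0 0 1 0 0 1
  have a3 := hz 0 1 0 0 1 0
  have a4 := hz 0 1 1 0 1 1
  have b1 := hz 0 0 0 1 0 0
  have b2 := hz 1 0 0 0 0 0
  have b3 := hz 0 0 0 0 1 0
  have b4 := hz 0 1 0 0 0 0
  have b5 := hz 0 0 0 0 0 1
  have b6 := hz 0 0 1 0 0 0
  simp [act, inOdd, sl_trace] at a1 a2 a3 a4 b1 b2 b3 b4 b5 b6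
  have c0 : 2 * (y.1 0).1 0 0 = 0 := by linear_combination a1 + a4
  have c1 : 2 * (y.1 1).1 0 0 = 0 := by linear_combination a2 - a4
  have c2 : 2 * (y.1 2).1 0 0 = 0 := by linear_combination a3 - a4
  have d0 := (mul_eq_zero.1 c0).resolve_left h2
  have d1 := (mul_eq_zero.1 c1).resolve_left h2
  have d2 := (mul_eq_zero.1 c2).resolve_left h2
  fin_cases i <;> fin_cases p <;> fin_cases q <;> simp [sl_trace, *]

/-! ### Roots, coroots and Chevalley bases -/

/-- The diagonal element `H_{2ε_i} = diag(1, -1)` of the `i`-th copy of `sl₂`. -/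
def diagH (K : Type*) [Field K] (i : Fin 3) : cartan K :=
  ⟨inEven i (slH K), Submodule.subset_span ⟨i, rfl⟩⟩

/-- The weight space `{x ∈ g | [H, x] = α(H) x for all H ∈ h}` of the adjoint action. -/
def rootSpace (a : K) (α : Module.Dual K (cartan K)) : Submodule K (Carrier K) :=
  ⨅ H : cartan K, LinearMap.ker (bracket a (H : Carrier K) - α H • LinearMap.id)

theorem mem_rootSpace (a : K) (α : Module.Dual K (cartan K)) (x : Carrier K) :
    x ∈ rootSpace a α ↔ ∀ H : cartan K, bracket a (H : Carrier K) x = α H • x := by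
  simp [rootSpace, sub_eq_zero]

/-- The set `Δ₀` of even roots. -/
def evenRoots (a : K) : Set (Module.Dual K (cartan K)) :=
  {α | α ≠ 0 ∧ rootSpace a α ⊓ part K 0 ≠ ⊥}

/-- The set `Δ₁` of odd roots. -/
def oddRoots (a : K) : Set (Module.Dual K (cartan K)) :=
  {α | rootSpace a α ⊓ part K 1 ≠ ⊥}

/-- The set `Δ = Δ₀ ∪ Δ₁` of roots. -/
def roots (a : K) : Set (Module.Dual K (cartan K)) := evenRoots a ∪ oddRoots a

/-- The set of negative odd roots `-ε₁ ± ε₂ ± ε₃`: the odd roots whose coefficient at `ε₁`,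
which is their value on `H_{2ε₁}`, is `-1`. -/
def negOddRoots (a : K) : Set (Module.Dual K (cartan K)) :=
  {α | α ∈ oddRoots a ∧ α (diagH K 0) = -1}

/-- The bilinear form on `h*` for which the basis `ε₁, ε₂, ε₃` dual to `H_{2ε₁}, H_{2ε₂}, H_{2ε₃}`
is orthogonal, with `(ε₁, ε₁) = -(1 + a) / 2`, `(ε₂, ε₂) = 1 / 2`, `(ε₃, ε₃) = a / 2`. -/
def form (a : K) (α β : Module.Dual K (cartan K)) : K :=
  ∑ i, sigma a i * α (diagH K i) * β (diagH K i)

/-- The element `t_α ∈ h` corresponding to `α` under the form: `β(t_α) = (α, β)` for all `β`. -/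
def dualVector (a : K) (α : Module.Dual K (cartan K)) : cartan K :=
  ∑ i, (sigma a i * α (diagH K i)) • diagH K i

theorem apply_dualVector (a : K) (α β : Module.Dual K (cartan K)) :
    β (dualVector a α) = form a α β := by
  simp [dualVector, form]

open Classical in
/-- The coroot `H_α` of a root `α`: `2 t_α / (α, α)` for the (non-isotropic) even roots, so that
`α(H_α) = 2`, and `-t_α` for the (isotropic) odd roots. -/
def coroot (a : K) (α : Module.Dual K (cartan K)) : cartan K :=
  if form a α α = 0 then -dualVector a α else (2 / form a α α) • dualVector a α

/-- The ring `ℤ[a]`, as a subring of `K`. -/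
def intAdjoin (a : K) : Subring K := Subring.closure {a}

/-- The ring `ℤ_a`: the subring of `K` generated by the binomial coefficients of the elements of
`ℤ[a]`. -/
def binomRing (a : K) : Subring K :=
  Subring.closure {z | ∃ P ∈ intAdjoin a, ∃ n : ℕ, z = binomCoeff K P n}

/-- A Chevalley basis `{H₁, H₂, H₃} ∪ {X_α}` of `D(2,1;a)`. -/
structure ChevalleyBasis (a : K) where
  H : Fin 3 → cartan K
  X : roots a → Carrier K
  linearIndependent :
    LinearIndependent K (Sum.elim (fun i => (H i : Carrier K)) X : Fin 3 ⊕ roots a → Carrier K)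
  span_eq_top : Submodule.span K
    (Set.range (Sum.elim (fun i => (H i : Carrier K)) X : Fin 3 ⊕ roots a → Carrier K)) = ⊤
  homogeneous : ∀ α, ∃ i, X α ∈ part K i
  span_H : Submodule.span K (Set.range H) = ⊤
  span_coroots : Submodule.span (intAdjoin a) (Set.range H) =
    Submodule.span (intAdjoin a) (coroot a '' roots a)
  bracket_H_H : ∀ i j, bracket a (H i : Carrier K) (H j) = 0
  bracket_H_X : ∀ i α, bracket a (H i : Carrier K) (X α) = α.1 (H i) • X α
  bracket_X_neg : ∀ α β : roots a, β.1 = -α.1 → α.1 ∉ negOddRoots a →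
    bracket a (X α) (X β) = coroot a α.1
  bracket_X_neg' : ∀ α β : roots a, β.1 = -α.1 → α.1 ∈ negOddRoots a →
    bracket a (X α) (X β) = -(coroot a α.1 : Carrier K)
  bracket_X_X_zero : ∀ α β : roots a, α.1 + β.1 ≠ 0 → α.1 + β.1 ∉ roots a →
    bracket a (X α) (X β) = 0
  /-- If `β - r α, …, β + q α` is the `α`-string through `β`, the structure constant is
  `± (r + 1)`. -/
  bracket_X_X : ∀ α β γ : roots a, α.1 + β.1 ≠ 0 → γ.1 = α.1 + β.1 →
    (form a α.1 α.1 ≠ 0 ∨ form a β.1 β.1 ≠ 0) →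
    ∃ r q : ℕ, {k : ℤ | β.1 + k • α.1 ∈ roots a ∪ {0}} = Set.Icc (-(r : ℤ)) q ∧
      (bracket a (X α) (X β) = ((r : K) + 1) • X γ ∨
        bracket a (X α) (X β) = -(((r : K) + 1) • X γ))
  bracket_X_X' : ∀ α β γ : roots a, α.1 + β.1 ≠ 0 → γ.1 = α.1 + β.1 →
    form a α.1 α.1 = 0 → form a β.1 β.1 = 0 →
    bracket a (X α) (X β) = β.1 (coroot a α.1) • X γ ∨
      bracket a (X α) (X β) = -(β.1 (coroot a α.1) • X γ)

/-! ### The Kostant superalgebra, rational modules and admissible lattices -/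

variable [CharZero K] {a : K} {V : Type*} [AddCommGroup V] [Module K V]

/-- The Kostant superalgebra: the `ℤ_a`-subalgebra of `U(g)` generated by the divided powers of
the even root vectors, the odd root vectors, and the binomial coefficients of the elements of
the `ℤ[a]`-span of `H₁, H₂, H₃`. -/
def kostant (B : ChevalleyBasis a) : Subalgebra (binomRing a) (LieSuperalgebra.Env (algebra a)) :=
  Algebra.adjoin (binomRing a)
    ({u | ∃ α : roots a, α.1 ∈ evenRoots a ∧ ∃ n : ℕ,
        u = dividedPow K (LieSuperalgebra.Env.of (algebra a) (B.X α)) n} ∪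
      {u | ∃ γ : roots a, γ.1 ∈ oddRoots a ∧ u = LieSuperalgebra.Env.of (algebra a) (B.X γ)} ∪
      {u | ∃ H ∈ Submodule.span (intAdjoin a) (Set.range B.H), ∃ n : ℕ,
        u = binomCoeff K (LieSuperalgebra.Env.of (algebra a) (H : Carrier K)) n})

/-- The weight space `V_μ = {v ∈ V | H . v = μ(H) v for all H ∈ h}`. -/
def weightSpace (ρ : LieSuperalgebra.Rep (algebra a) V) (μ : Module.Dual K (cartan K)) :
    Submodule K V :=
  ⨅ H : cartan K, LinearMap.ker (ρ.toHom (H : Carrier K) - μ H • 1)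

theorem mem_weightSpace (ρ : LieSuperalgebra.Rep (algebra a) V) (μ : Module.Dual K (cartan K))
    (v : V) : v ∈ weightSpace ρ μ ↔ ∀ H : cartan K, ρ.toHom (H : Carrier K) v = μ H • v := by
  simp [weightSpace, sub_eq_zero]

/-- The set `Λ` of weights of `V`. -/
def weights (ρ : LieSuperalgebra.Rep (algebra a) V) : Set (Module.Dual K (cartan K)) :=
  {μ | weightSpace ρ μ ≠ ⊥}

/-- Rational modules.  The sum of the weight spaces is automatically direct. -/
structure IsRational (B : ChevalleyBasis a) (ρ : LieSuperalgebra.Rep (algebra a) V) : Prop where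
  iSup_weightSpace : ⨆ μ, weightSpace ρ μ = ⊤
  apply_H : ∀ μ ∈ weights ρ, ∀ i, μ (B.H i) ∈ intAdjoin a
  apply_coroot : ∀ μ ∈ weights ρ, ∀ α ∈ evenRoots a, ∃ n : ℤ, μ (coroot a α) = n

/-- Admissible lattices: the `ℤ_a`-lattices of `V` that are stable under the Kostant
superalgebra. -/
structure IsAdmissible (B : ChevalleyBasis a) (ρ : LieSuperalgebra.Rep (algebra a) V)
    (M : Submodule (binomRing a) V) : Prop where
  isLattice : IsLatticeOver (binomRing a) M
  stable : ∀ u ∈ kostant B, ∀ m ∈ M, ρ.envAction u m ∈ M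

/-- `h_V = {H ∈ h | μ(H) ∈ ℤ_a for all weights μ of V}`, as a `ℤ_a`-submodule of `g`. -/
def cartanStabilizer (ρ : LieSuperalgebra.Rep (algebra a) V) :
    Submodule (binomRing a) (Carrier K) where
  carrier := {x | ∃ H : cartan K, (H : Carrier K) = x ∧ ∀ μ ∈ weights ρ, μ H ∈ binomRing a}
  zero_mem' := ⟨0, rfl, fun μ _ => by simp⟩
  add_mem' := by
    rintro _ _ ⟨x, rfl, hx⟩ ⟨y, rfl, hy⟩
    exact ⟨x + y, rfl, fun μ hμ => by simpa using add_mem (hx μ hμ) (hy μ hμ)⟩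
  smul_mem' := by
    rintro c _ ⟨x, rfl, hx⟩
    exact ⟨(c : K) • x, rfl, fun μ hμ => by simpa using mul_mem c.2 (hx μ hμ)⟩

end D21

end

noncomputable section

/-! ### Binomial coefficients and the ring `ℤ_a` -/

/-! The content is the inclusion of `𝔤_V` in the right-hand side: if `x` preserves `M`, its Cartan
part takes values in `ℤ_a` on all weights, and its coefficient at each `X_α` lies in `ℤ_a`.

Weight projections reduce this to one component at a time. A weight is determined by its values on
the three coroots `H_{2ε_i}`, which are integers by rationality. Since `V` has finitely many
weights, products of binomial coefficients in shifts of `±H_{2ε_i}` give the projection `e_μ` to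
each weight space, and these operators preserve `M` (`exists_weight_projection`). Compressing `x`
between such projections isolates its Cartan part and each term `c X_α`, and all of these preserve
`M` (`component_mem_latticeEnd`).

Scalars are recovered from `mem_of_smul_idempotent`: if `e ≠ 0` is idempotent and both `e` and `c e`
preserve a lattice over `R`, then `c ∈ R`. The image of `e` on the lattice is not shown to be free.
Instead, the matrix entries of `e` generate a finitely generated idempotent ideal of a domain; it is
nonzero, hence the whole ring. Applied to `e_μ`, this identifies `𝔥_V`, since `H = ∑ μ(H) e_μ` on
`V`.

For an even root `α` and `c X_α` preserving `M`, choose a weight `μ` with `m = |μ(H_α)|` maximal;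
faithfulness gives `m > 0`. Vectors of `V_μ` are killed by `X_α` or by `X_{-α}`. The commutator with
`X_{-α}` gives `c m ∈ ℤ_a`, and `(c X_α) ^ m` combined with the divided power `X_{-α} ^ m / m!` acts
on `V_μ` by `c ^ m m!`, so `c ^ m m! ∈ ℤ_a`. These two facts imply `c ∈ ℤ_a`
(`mem_of_mul_mem_of_pow_mul_factorial_mem`), because `v_p(m!) < m` and `ℤ_a / p ℤ_a` is reduced for
every prime `p`. Reducedness follows from `x ^ p ≡ x` modulo `p`, which holds on `ℤ_a` because `(f ^
p - f) / p` is integer-valued whenever `f` is.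

An odd `α` is reduced to an even root by an odd `β` with `[X_α, X_β] = ± X_{α+β}`. Finally, the
weights generate a subgroup of full rank in a copy of `ℤ³`, so `𝔥_V` is spanned over `ℤ_a` by the
dual basis (`exists_basis_dual_to_weights`); hence `𝔤_V` is a lattice. -/

theorem map_binomCoeff {K A B : Type*} [Field K] [Ring A] [Algebra K A] [Ring B] [Algebra K B]
    (f : A →ₐ[K] B) (y : A) (n : ℕ) : f (binomCoeff K y n) = binomCoeff K (f y) n := by
  rw [binomCoeff, binomCoeff, map_smul, Polynomial.aeval_algHom_apply]

theorem map_dividedPow {K A B : Type*} [Field K] [Ring A] [Algebra K A] [Ring B] [Algebra K B]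
    (f : A →ₐ[K] B) (y : A) (n : ℕ) : f (dividedPow K y n) = dividedPow K (f y) n := by
  rw [dividedPow, dividedPow, map_smul, map_pow]

section

variable {K : Type*} [Field K] [CharZero K]

theorem binomCoeff_natCast (m n : ℕ) : binomCoeff K (m : K) n = (m.choose n : K) := by
  rw [binomCoeff, Polynomial.coe_aeval_eq_eval, descPochhammer_eval_eq_descFactorial,
    Nat.descFactorial_eq_factorial_mul_choose, smul_eq_mul, Nat.cast_mul,
    inv_mul_cancel_left₀ (Nat.cast_ne_zero.2 n.factorial_ne_zero)]

omit [CharZero K] in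
theorem natDegree_binomCoeff_X_le (n : ℕ) :
    (binomCoeff K (Polynomial.X : Polynomial K) n).natDegree ≤ n := by
  rw [binomCoeff, Polynomial.aeval_X_left_apply]
  exact (Polynomial.natDegree_smul_le _ _).trans (descPochhammer_natDegree K n).le

omit [CharZero K] in
theorem eval_binomCoeff_X (x : K) (n : ℕ) :
    (binomCoeff K (Polynomial.X : Polynomial K) n).eval x = binomCoeff K x n := by
  rw [← Polynomial.coe_aeval_eq_eval, map_binomCoeff, Polynomial.aeval_X]

/-- Any sequence of integers is interpolated on `0, …, d` by an integral combination of binomial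
polynomials of degree at most `d`. -/
theorem exists_binomCoeff_interpolation (c : ℕ → ℤ) (d : ℕ) :
    ∃ g ∈ AddSubgroup.closure (Set.range (binomCoeff K (Polynomial.X : Polynomial K))),
      g.natDegree ≤ d ∧ ∀ i ≤ d, g.eval (i : K) = c i := by
  -- Integrality at all natural numbers, not only at the nodes, makes the next Newton coefficient `c
  -- (d + 1) - g(d + 1)` an integer.
  have hval : ∀ g ∈ AddSubgroup.closure (Set.range (binomCoeff K (Polynomial.X : Polynomial K))),
      ∀ m : ℕ, ∃ z : ℤ, g.eval (m : K) = z := by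
    intro g hg m
    induction hg using AddSubgroup.closure_induction with
    | mem x hx =>
      obtain ⟨n, rfl⟩ := hx
      exact ⟨m.choose n, by rw [eval_binomCoeff_X, binomCoeff_natCast]; simp⟩
    | zero => exact ⟨0, by simp⟩
    | add x y _ _ hx hy =>
      obtain ⟨z, hz⟩ := hx
      obtain ⟨w, hw⟩ := hy
      exact ⟨z + w, by simp [hz, hw]⟩
    | neg x _ hx =>
      obtain ⟨z, hz⟩ := hx
      exact ⟨-z, by simp [hz]⟩
  induction d with
  | zero =>
    refine ⟨c 0 • binomCoeff K (Polynomial.X : Polynomial K) 0,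
      zsmul_mem (AddSubgroup.subset_closure (Set.mem_range_self 0)) _,
      (Polynomial.natDegree_smul_le _ _).trans (natDegree_binomCoeff_X_le 0), ?_⟩
    intro i hi
    obtain rfl : i = 0 := by omega
    rw [Polynomial.eval_smul, eval_binomCoeff_X, binomCoeff_natCast]
    simp
  | succ d ih =>
    obtain ⟨g, hg, hdeg, hev⟩ := ih
    obtain ⟨z, hz⟩ := hval g hg (d + 1)
    -- Newton interpolation: the binomial polynomial of degree `d + 1` vanishes at `0, …, d` and
    -- equals `1` at `d + 1`.
    refine ⟨g + (c (d + 1) - z) • binomCoeff K (Polynomial.X : Polynomial K) (d + 1),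
      add_mem hg (zsmul_mem (AddSubgroup.subset_closure (Set.mem_range_self (d + 1))) _), ?_, ?_⟩
    · refine (Polynomial.natDegree_add_le _ _).trans (max_le (by omega) ?_)
      exact (Polynomial.natDegree_smul_le _ _).trans (natDegree_binomCoeff_X_le _)
    · intro i hi
      rw [Polynomial.eval_add, Polynomial.eval_smul, eval_binomCoeff_X, binomCoeff_natCast]
      rcases Nat.lt_or_ge i (d + 1) with h | h
      · rw [Nat.choose_eq_zero_of_lt h, hev i (by omega)]
        simp
      · obtain rfl : i = d + 1 := by omega
        rw [hz]
        simp

/-- Integer-valued polynomials are integral combinations of binomial polynomials. -/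
theorem mem_closure_binomCoeff {f : Polynomial K} (hf : ∀ m : ℕ, ∃ z : ℤ, f.eval (m : K) = z) :
    f ∈ AddSubgroup.closure (Set.range (binomCoeff K (Polynomial.X : Polynomial K))) := by
  choose c hc using hf
  obtain ⟨g, hg, hdeg, hev⟩ := exists_binomCoeff_interpolation (K := K) c f.natDegree
  suffices h : f = g from h ▸ hg
  refine Polynomial.eq_of_natDegree_lt_card_of_eval_eq f g
    (f := fun i : Fin (f.natDegree + 1) => ((i : ℕ) : K))
    (Nat.cast_injective.comp Fin.val_injective) (fun i => ?_) ?_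
  · rw [hc, hev i (by omega)]
  · simpa using hdeg

/-- This lets one divide inside `R`: a polynomial in `P` may be divided by `p` as soon as the
quotient is integral at every natural number, whatever `P` is. -/
theorem aeval_mem_of_integerValued {R : Subring K} {P : K} (hP : ∀ n, binomCoeff K P n ∈ R)
    {f : Polynomial K} (hf : ∀ m : ℕ, ∃ z : ℤ, f.eval (m : K) = z) : f.eval P ∈ R := by
  have h := mem_closure_binomCoeff hf
  clear hf
  induction h using AddSubgroup.closure_induction with
  | mem x hx =>
    obtain ⟨n, rfl⟩ := hx
    rw [eval_binomCoeff_X]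
    exact hP n
  | zero => simp
  | add x y _ _ hx hy => rw [Polynomial.eval_add]; exact add_mem hx hy
  | neg x _ hx => rw [Polynomial.eval_neg]; exact neg_mem hx

/-! ### Frobenius congruences and denominators in `ℤ_a` -/

namespace D21

/-- Every element of `ℤ_a` is fixed by the Frobenius modulo each prime. -/
theorem pow_prime_sub_self_mem (a : K) {p : ℕ} (hp : p.Prime) {x : K} (hx : x ∈ binomRing a) :
    ∃ y ∈ binomRing a, x ^ p - x = p * y := by
  have hp0 : (p : K) ≠ 0 := Nat.cast_ne_zero.2 hp.ne_zero
  -- The binomial formula modulo `p`, with remainder in `ℤ_a`; it serves both sums and negatives.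
  have add' : ∀ u ∈ binomRing a, ∀ v ∈ binomRing a, ∃ r ∈ binomRing a,
      (u + v) ^ p = u ^ p + v ^ p + p * r := by
    intro u hu v hv
    obtain ⟨r, hr⟩ := exists_add_pow_prime_eq hp (⟨u, hu⟩ : binomRing a) ⟨v, hv⟩
    refine ⟨u * v * r, mul_mem (mul_mem hu hv) r.2, ?_⟩
    have := congrArg Subtype.val hr
    simp only [Subring.coe_add, Subring.coe_pow, Subring.coe_mul, Subring.coe_natCast] at this
    rw [this]
    ring
  have hx' := hx
  induction hx using Subring.closure_induction with
  | mem x hx =>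
    obtain ⟨P, hP, n, rfl⟩ := hx
    let b := binomCoeff K (Polynomial.X : Polynomial K) n
    have hPk : ∀ k, binomCoeff K P k ∈ binomRing a := fun k =>
      Subring.subset_closure ⟨P, hP, k, rfl⟩
    -- By Fermat's little theorem `(b ^ p - b) / p` is integer-valued, so its value at `P` stays in
    -- `ℤ_a`.
    have h : ((p : K)⁻¹ • (b ^ p - b)).eval P ∈ binomRing a := by
      refine aeval_mem_of_integerValued hPk ?_
      intro m
      have hz : (p : ℤ) ∣ (m.choose n : ℤ) ^ p - (m.choose n : ℤ) := by
        have : Fact p.Prime := ⟨hp⟩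
        rw [← ZMod.intCast_zmod_eq_zero_iff_dvd]
        simp
      obtain ⟨z, hz⟩ := hz
      refine ⟨z, ?_⟩
      have hz' := congrArg (Int.cast : ℤ → K) hz
      push_cast at hz'
      rw [Polynomial.eval_smul, Polynomial.eval_sub, Polynomial.eval_pow, eval_binomCoeff_X,
        binomCoeff_natCast, hz', smul_eq_mul, inv_mul_cancel_left₀ hp0]
    refine ⟨_, h, ?_⟩
    rw [Polynomial.eval_smul, Polynomial.eval_sub, Polynomial.eval_pow, eval_binomCoeff_X,
      smul_eq_mul, mul_inv_cancel_left₀ hp0]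
  | zero => exact ⟨0, zero_mem _, by simp [hp.ne_zero]⟩
  | one => exact ⟨0, zero_mem _, by simp⟩
  | add u v hu hv ihu ihv =>
    obtain ⟨y, hy, hy'⟩ := ihu hu
    obtain ⟨z, hz, hz'⟩ := ihv hv
    obtain ⟨r, hr, hr'⟩ := add' u hu v hv
    exact ⟨y + z + r, add_mem (add_mem hy hz) hr, by linear_combination hr' + hy' + hz'⟩
  | mul u v hu hv ihu ihv =>
    obtain ⟨y, hy, hy'⟩ := ihu hu
    obtain ⟨z, hz, hz'⟩ := ihv hv
    refine ⟨y * v ^ p + u * z, add_mem (mul_mem hy (pow_mem hv p)) (mul_mem hu hz), ?_⟩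
    rw [mul_pow]
    linear_combination v ^ p * hy' + u * hz'
  | neg u hu ihu =>
    obtain ⟨y, hy, hy'⟩ := ihu hu
    -- Expanding `(u + (-u)) ^ p = 0` avoids treating `p = 2` apart, where `(-1) ^ p` is not `-1`.
    obtain ⟨r, hr, hr'⟩ := add' u hu (-u) (neg_mem hu)
    rw [add_neg_cancel, zero_pow hp.ne_zero] at hr'
    exact ⟨-y - r, sub_mem (neg_mem hy) hr, by linear_combination -hr' - hy'⟩

/-- `ℤ_a / p ℤ_a` is reduced for each prime `p`. -/
theorem mem_of_prime_pow (a : K) {p : ℕ} (hp : p.Prime) {x : K} (hx : x ∈ binomRing a)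
    {n : ℕ} {y : K} (hy : y ∈ binomRing a) (h : x ^ n = p * y) :
    ∃ z ∈ binomRing a, x = p * z := by
  have step : ∀ k : ℕ, ∃ z ∈ binomRing a, x ^ p ^ k - x = p * z := by
    intro k
    induction k with
    | zero => exact ⟨0, zero_mem _, by simp⟩
    | succ k ih =>
      obtain ⟨z, hz, hz'⟩ := ih
      obtain ⟨w, hw, hw'⟩ := pow_prime_sub_self_mem a hp (pow_mem hx (p ^ k))
      exact ⟨w + z, add_mem hw hz, by rw [pow_succ, pow_mul]; linear_combination hw' + hz'⟩
  obtain ⟨z, hz, hz'⟩ := step n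
  -- Since `p ^ n ≥ n`, the power `x ^ p ^ n` is a multiple of `x ^ n`, hence of `p`; it is also
  -- congruent to `x`.
  have hle : n ≤ p ^ n := (Nat.lt_pow_self hp.one_lt).le
  refine ⟨x ^ (p ^ n - n) * y - z, sub_mem (mul_mem (pow_mem hx _) hy) hz, ?_⟩
  have : x ^ p ^ n = x ^ (p ^ n - n) * x ^ n := by rw [← pow_add, Nat.sub_add_cancel hle]
  linear_combination this + x ^ (p ^ n - n) * h - hz'

/-- An element `c` with `c m ∈ ℤ_a` and `c ^ m m! ∈ ℤ_a` for some `m ≥ 1` lies in `ℤ_a`. -/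
theorem mem_of_mul_mem_of_pow_mul_factorial_mem (a : K) {c : K} {m : ℕ} (hm : m ≠ 0)
    (h : c * m ∈ binomRing a) (h' : c ^ m * (m ! : K) ∈ binomRing a) : c ∈ binomRing a := by
  classical
  have hex : ∃ n : ℕ, n ≠ 0 ∧ c * n ∈ binomRing a := ⟨m, hm, h⟩
  -- `n` is the least positive denominator of `c`. If it is not `1`, a prime factor of it can be
  -- cancelled, against minimality.
  obtain ⟨hn0, hn⟩ := Nat.find_spec hex
  have hmin := fun k => Nat.find_min hex (m := k)
  generalize Nat.find hex = n at *
  by_cases hn1 : n = 1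
  · simpa [hn1] using hn
  exfalso
  obtain ⟨p, hp, n', rfl⟩ := Nat.exists_prime_and_dvd hn1
  have hp0 : (p : K) ≠ 0 := Nat.cast_ne_zero.2 hp.ne_zero
  have hn'0 : n' ≠ 0 := by rintro rfl; simp at hn0
  have : Fact p.Prime := ⟨hp⟩
  obtain ⟨u, hu⟩ : p ^ padicValNat p (m !) ∣ m ! := pow_padicValNat_dvd
  -- Legendre's formula: `(p - 1) v_p(m!)` is `m` minus the sum of the base `p` digits of `m`, and
  -- that sum is positive because the leading digit is nonzero.
  have hlt : padicValNat p (m !) < m := by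
    have h1 := sub_one_mul_padicValNat_factorial (p := p) m
    have h2 : 0 < (p.digits m).sum := by
      by_contra h0
      have h0 : (p.digits m).sum = 0 := by omega
      rw [List.sum_eq_zero_iff] at h0
      exact Nat.getLast_digit_ne_zero p hm (h0 _ (List.getLast_mem _))
    have h3 : 1 ≤ p - 1 := by have := hp.two_le; omega
    have h4 := Nat.mul_le_mul_right (padicValNat p (m !)) h3
    have h5 : 0 < m := Nat.pos_of_ne_zero hm
    omega
  have hcop : ¬ p ∣ u := by
    rintro ⟨w, rfl⟩
    have : p ^ (padicValNat p (m !) + 1) ∣ m ! := ⟨w, by rw [pow_succ, mul_assoc]; exact hu⟩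
    exact pow_succ_padicValNat_not_dvd m.factorial_ne_zero this
  generalize padicValNat p (m !) = e at *
  have hu' : (m ! : K) = p ^ e * u := by exact_mod_cast congrArg (Nat.cast : ℕ → K) hu
  have hb : c * ((p * n' : ℕ) : K) ∈ binomRing a := hn
  set b := c * ((p * n' : ℕ) : K) with hbdef
  -- With `b = c p n'`, one has `b ^ m m! = p ^ m n' ^ m (c ^ m m!)`. Cancelling `p ^ e` leaves `p ^
  -- (m - e)`, which contains at least one factor `p`.
  have hbu : b ^ m * u = p * (p ^ (m - e - 1) * (n' ^ m * (c ^ m * (m ! : K)))) := by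
    have : (p : K) ^ m = p * p ^ (m - e - 1) * p ^ e := by
      rw [← pow_succ', ← pow_add]
      congr 1
      omega
    rw [hbdef, hu']
    push_cast
    rw [mul_pow, mul_pow, this]
    ring
  have hiso : IsCoprime (p : ℤ) (u : ℤ) :=
    Nat.isCoprime_iff_coprime.2 ((Nat.Prime.coprime_iff_not_dvd hp).2 hcop)
  obtain ⟨s, t, hst⟩ := hiso
  have hst' : (s : K) * p + t * u = 1 := by exact_mod_cast congrArg (Int.cast : ℤ → K) hst
  have hY : (p : K) ^ (m - e - 1) * (n' ^ m * (c ^ m * (m ! : K))) ∈ binomRing a :=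
    mul_mem (pow_mem (natCast_mem _ _) _) (mul_mem (pow_mem (natCast_mem _ _) _) h')
  generalize (p : K) ^ (m - e - 1) * (n' ^ m * (c ^ m * (m ! : K))) = Y at *
  -- The Bézout relation inverts `u` modulo `p`, so `b ^ m ∈ p ℤ_a`; reducedness then gives `b ∈ p
  -- ℤ_a`.
  obtain ⟨z, hz, hbz⟩ := mem_of_prime_pow a hp hb (n := m) (y := s * b ^ m + t * Y)
    (add_mem (mul_mem (intCast_mem _ _) (pow_mem hb _)) (mul_mem (intCast_mem _ _) hY))
    (by linear_combination (-b ^ m) * hst' + t * hbu)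
  refine hmin n' ?_ ⟨hn'0, ?_⟩
  · have := hp.two_le
    nlinarith [Nat.pos_of_ne_zero hn'0]
  · have : c * n' = z := by
      apply mul_left_cancel₀ hp0
      rw [← hbz, hbdef]
      push_cast
      ring
    rwa [this]

end D21
end

/-! ### Idempotents preserving a lattice -/

/-- If an idempotent `e ≠ 0` and its multiple `c • e` preserve an `R`-lattice, then `c ∈ R`. -/
theorem mem_of_smul_idempotent {K V : Type*} [Field K] [AddCommGroup V] [Module K V]
    [FiniteDimensional K V] {R : Subring K} {M : Submodule R V} (hM : IsLatticeOver R M)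
    {e : Module.End K V} (he : e * e = e) (he0 : e ≠ 0) (heM : ∀ m ∈ M, e m ∈ M) {c : K}
    (hc : ∀ m ∈ M, c • e m ∈ M) : c ∈ R := by
  classical
  obtain ⟨s, hs, hspan, rfl⟩ := hM
  let b : Module.Basis s K V := Module.Basis.mk hs (by simpa using hspan.ge)
  have hb : ∀ i, b i = i := fun i => by simp [b]
  have : Fintype s := FiniteDimensional.fintypeBasisIndex b
  have hmem : ∀ i, b i ∈ Submodule.span R s := fun i => Submodule.subset_span (by simp [hb])
  have hcoord : ∀ m ∈ Submodule.span R s, ∀ i, b.repr m i ∈ R := by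
    intro m hm i
    induction hm using Submodule.span_induction with
    | mem x hx =>
      have h := b.repr_self_apply ⟨x, hx⟩ i
      rw [hb] at h
      rw [h]
      split_ifs
      exacts [R.one_mem, R.zero_mem]
    | zero => simp
    | add x y _ _ hx hy => simpa using add_mem hx hy
    | smul r x _ hx => simpa [Subring.smul_def] using mul_mem r.2 hx
  -- The matrix of `e` in a basis of the lattice has entries in `R`. From `e * e = e`, each entry is
  -- a sum of products of entries, so the ideal `I` of all entries satisfies `I * I = I`.
  let A : s × s → R := fun ij => ⟨b.repr (e (b ij.2)) ij.1, hcoord _ (heM _ (hmem _)) _⟩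
  let I : Ideal R := Ideal.span (Set.range A)
  have hfg : I.FG := ⟨Finset.univ.image A, by simp [I]⟩
  have hA : ∀ i j, A (i, j) = ∑ k, A (i, k) * A (k, j) := by
    intro i j
    apply Subtype.ext
    have h1 : e (b j) = ∑ k, b.repr (e (b j)) k • e (b k) := by
      conv_lhs => rw [← he, Module.End.mul_apply, ← b.sum_repr (e (b j)), map_sum]
      simp
    have h2 := congrArg (fun v => b.repr v i) h1
    simp only [map_sum, map_smul, Finsupp.coe_finsetSum, Finset.sum_apply, Finsupp.smul_apply,
      smul_eq_mul] at h2
    simp only [A, AddSubmonoidClass.coe_finsetSum, Subring.coe_mul]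
    rw [h2]
    exact Finset.sum_congr rfl fun k _ => mul_comm _ _
  have hidem : IsIdempotentElem I := by
    refine le_antisymm Ideal.mul_le_left ?_
    rw [Ideal.span_le]
    rintro _ ⟨⟨i, j⟩, rfl⟩
    rw [SetLike.mem_coe, hA]
    exact Ideal.sum_mem _ fun k _ =>
      Ideal.mul_mem_mul (Ideal.subset_span ⟨_, rfl⟩) (Ideal.subset_span ⟨_, rfl⟩)
  have htop : I = ⊤ := by
    refine ((Ideal.isIdempotentElem_iff_eq_bot_or_top I hfg).1 hidem).resolve_left fun hbot => ?_
    apply he0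
    refine b.ext fun j => b.repr.injective (Finsupp.ext fun i => ?_)
    have : A (i, j) ∈ I := Ideal.subset_span ⟨_, rfl⟩
    rw [hbot, Ideal.mem_bot] at this
    simpa [A] using congrArg Subtype.val this
  -- The entries of `c A` also lie in `R`, so multiplication by `c` maps `I` into `R`; as `I` is the
  -- unit ideal, this applies to `1`.
  have key : ∀ x ∈ I, c * (x : K) ∈ R := by
    intro x hx
    induction hx using Submodule.span_induction with
    | mem x hx =>
      obtain ⟨⟨i, j⟩, rfl⟩ := hx
      simpa using hcoord _ (hc _ (hmem j)) i
    | zero => simp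
    | add x y _ _ hx hy => simpa [mul_add] using add_mem hx hy
    | smul r x _ hx =>
      have := mul_mem r.2 hx
      simpa [mul_left_comm] using this
  simpa using key 1 (htop ▸ Submodule.mem_top)

/-! ### Binomial coefficients under integer shifts -/

section BinomShift

variable {K A : Type*} [Field K] [Ring A] [Algebra K A]

theorem binomCoeff_zero (y : A) : binomCoeff K y 0 = 1 := by simp [binomCoeff]

/-- Pascal's rule, valid at any element of an algebra because it is the polynomial identity for
`descPochhammer` composed with `X - 1`, evaluated at `y + 1`. -/
theorem binomCoeff_add_one [CharZero K] (y : A) (n : ℕ) :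
    binomCoeff K (y + 1) (n + 1) = binomCoeff K y (n + 1) + binomCoeff K y n := by
  have hcomp : ∀ p : Polynomial K, Polynomial.aeval (y + 1) (p.comp (Polynomial.X - 1)) =
      Polynomial.aeval y p := fun p => by simp [Polynomial.aeval_comp]
  have h := congrArg (Polynomial.aeval (y + 1)) (descPochhammer_succ_comp_X_sub_one K n)
  rw [hcomp, map_sub, smul_eq_mul, map_mul, hcomp] at h
  have h' : Polynomial.aeval (y + 1) (descPochhammer K (n + 1)) =
      Polynomial.aeval y (descPochhammer K (n + 1)) +
        ((n : K) + 1) • Polynomial.aeval y (descPochhammer K n) := by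
    rw [h, Algebra.smul_def]
    simp
  have hn : ((n : K) + 1) ≠ 0 := by exact_mod_cast n.succ_ne_zero
  have hf : (n ! : K) ≠ 0 := Nat.cast_ne_zero.2 n.factorial_ne_zero
  rw [binomCoeff, h', smul_add, binomCoeff, binomCoeff, smul_smul, Nat.factorial_succ]
  congr 2
  push_cast
  field_simp

/-- Pascal's rule expresses the shift by `1` through the unshifted coefficients. For the shift by
`-1` it is solved backwards, by an inner induction on `n`. -/
theorem binomCoeff_add_intCast_mem [CharZero K] {S : Subring A} {y : A}
    (hy : ∀ n, binomCoeff K y n ∈ S) (k : ℤ) : ∀ n, binomCoeff K (y + k) n ∈ S := by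
  induction k with
  | zero => simpa using hy
  | succ k ih =>
    rintro (_ | n)
    · rw [binomCoeff_zero]; exact S.one_mem
    · push_cast at ih ⊢
      rw [← add_assoc, binomCoeff_add_one]
      exact add_mem (ih _) (ih _)
  | pred k ih =>
    intro n
    induction n with
    | zero => rw [binomCoeff_zero]; exact S.one_mem
    | succ n ihn =>
      have h := binomCoeff_add_one (K := K) (y + ((-k - 1 : ℤ) : A)) n
      rw [← sub_eq_iff_eq_add] at h
      rw [← h]
      refine sub_mem ?_ ihn
      convert ih (n + 1) using 2
      push_cast
      abel

end BinomShift

/-! ### Operators on integral eigenvectors and on `sl₂`-strings -/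

section Operators

variable {K V : Type*} [Field K] [AddCommGroup V] [Module K V]

theorem aeval_apply_of_apply_eq_smul {T : Module.End K V} {v : V} {t : K} (h : T v = t • v)
    (p : Polynomial K) : Polynomial.aeval T p v = p.eval t • v := by
  induction p using Polynomial.induction_on' with
  | add p q hp hq => simp [hp, hq, add_smul]
  | monomial n c =>
    have hn : ∀ n : ℕ, (T ^ n) v = t ^ n • v := by
      intro n
      induction n with
      | zero => simp
      | succ n ih => rw [pow_succ', Module.End.mul_apply, ih, map_smul, h, smul_smul, pow_succ]
    simp [Polynomial.aeval_monomial, hn, smul_smul, mul_comm]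

theorem binomCoeff_apply_of_apply_eq_smul {T : Module.End K V} {v : V} {t : K} (h : T v = t • v)
    (n : ℕ) : binomCoeff K T n v = binomCoeff K t n • v := by
  rw [binomCoeff, binomCoeff, LinearMap.smul_apply, aeval_apply_of_apply_eq_smul h, smul_smul,
    Polynomial.coe_aeval_eq_eval, smul_eq_mul]

/-- An operator acting as the indicator function of `k` on the integral eigenvectors of `T` whose
eigenvalue has distance at most `N` from `k`. -/
def indicatorOp (T : Module.End K V) (k : ℤ) (N : ℕ) : Module.End K V :=
  binomCoeff K (T + ((N - k : ℤ) : Module.End K V)) N *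
    binomCoeff K (-T + ((N + k : ℤ) : Module.End K V)) N

theorem indicatorOp_apply [CharZero K] {T : Module.End K V} {k z : ℤ} {N : ℕ} {v : V}
    (h : T v = (z : K) • v) (hz : |z - k| ≤ N) :
    indicatorOp T k N v = if z = k then v else 0 := by
  rw [abs_le] at hz
  obtain ⟨i, hi⟩ := Int.eq_ofNat_of_zero_le (show 0 ≤ z + (N - k) by omega)
  obtain ⟨j, hj⟩ := Int.eq_ofNat_of_zero_le (show 0 ≤ -z + (N + k) by omega)
  have hint : ∀ w : ℤ, (w : Module.End K V) v = (w : K) • v := fun w => by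
    rw [Module.End.intCast_apply, Int.cast_smul_eq_zsmul]
  have hi' : ((i : ℕ) : K) = ((z + (N - k) : ℤ) : K) := by rw [hi]; simp
  have hj' : ((j : ℕ) : K) = ((-z + (N + k) : ℤ) : K) := by rw [hj]; simp
  have h1 : (T + ((N - k : ℤ) : Module.End K V)) v = ((i : ℕ) : K) • v := by
    rw [LinearMap.add_apply, h, hint, ← add_smul, hi', Int.cast_add]
  have h2 : (-T + ((N + k : ℤ) : Module.End K V)) v = ((j : ℕ) : K) • v := by
    rw [LinearMap.add_apply, LinearMap.neg_apply, h, hint, ← neg_smul, ← add_smul, hj',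
      Int.cast_add (-z), Int.cast_neg]
  rw [indicatorOp, Module.End.mul_apply, binomCoeff_apply_of_apply_eq_smul h2, map_smul,
    binomCoeff_apply_of_apply_eq_smul h1, binomCoeff_natCast, binomCoeff_natCast, smul_smul]
  -- The scalars are `C(i, N)` and `C(j, N)` with `i = N + (z - k)` and `j = N - (z - k)`. Both are
  -- `1` at `z = k`; the first vanishes for `z < k`, the second for `z > k`.
  split_ifs with hzk
  · obtain rfl : i = N := by omega
    obtain rfl : j = i := by omega
    simp
  · rcases lt_or_gt_of_ne hzk with hlt | hlt
    · rw [Nat.choose_eq_zero_of_lt (show i < N by omega)]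
      simp
    · rw [Nat.choose_eq_zero_of_lt (show j < N by omega)]
      simp

/-- The ring of the operators that preserve a lattice. -/
def latticeEnd {R : Subring K} (M : Submodule R V) : Subring (Module.End K V) where
  carrier := {T | ∀ m ∈ M, T m ∈ M}
  mul_mem' := fun hS hT m hm => hS _ (hT m hm)
  one_mem' := fun _ hm => hm
  add_mem' := fun hS hT m hm => M.add_mem (hS m hm) (hT m hm)
  zero_mem' := fun _ _ => M.zero_mem
  neg_mem' := fun hS m hm => M.neg_mem (hS m hm)

theorem indicatorOp_mem [CharZero K] {S : Subring (Module.End K V)} {T : Module.End K V}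
    (hT : ∀ n, binomCoeff K T n ∈ S) (hT' : ∀ n, binomCoeff K (-T) n ∈ S) (k : ℤ) (N : ℕ) :
    indicatorOp T k N ∈ S :=
  mul_mem (binomCoeff_add_intCast_mem hT _ _) (binomCoeff_add_intCast_mem hT' _ _)

/-- The action of `e ^ m f ^ m` on a primitive vector of weight `m` of an `sl₂`-triple. -/
theorem pow_mul_pow_apply_of_primitive {e f h : Module.End K V} (hef : e * f - f * e = h)
    (hhf : h * f - f * h = -(2 : K) • f) {v : V} {m : ℕ} (hv : h v = (m : K) • v)
    (hev : e v = 0) : (e ^ m) ((f ^ m) v) = ((m ! : K) * m !) • v := by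
  have hh : ∀ j : ℕ, h ((f ^ j) v) = ((m : K) - 2 * j) • (f ^ j) v := by
    intro j
    induction j with
    | zero => simp [hv]
    | succ j ih =>
      have := LinearMap.congr_fun hhf ((f ^ j) v)
      simp only [LinearMap.sub_apply, Module.End.mul_apply, ih, map_smul, LinearMap.smul_apply]
        at this
      rw [pow_succ', Module.End.mul_apply, sub_eq_iff_eq_add.1 this, ← add_smul]
      push_cast
      congr 1
      ring
  have he : ∀ j : ℕ, e ((f ^ (j + 1)) v) = (((j : K) + 1) * (m - j)) • (f ^ j) v := by
    intro j
    induction j with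
    | zero =>
      have := LinearMap.congr_fun hef v
      simp only [LinearMap.sub_apply, Module.End.mul_apply, hev, map_zero, sub_zero, hv] at this
      simp [this]
    | succ j ih =>
      have := LinearMap.congr_fun hef ((f ^ (j + 1)) v)
      simp only [LinearMap.sub_apply, Module.End.mul_apply, ih, map_smul, hh] at this
      rw [pow_succ' f (j + 1), Module.End.mul_apply, sub_eq_iff_eq_add.1 this,
        ← Module.End.mul_apply f, ← pow_succ', ← add_smul]
      push_cast
      congr 1
      ring
  -- The factors `(j + 1) (m - j)` from `he` accumulate to `j!` times a falling factorial of `m`; at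
  -- `j = m` the product is `m! ^ 2`.
  have key : ∀ j ≤ m, (e ^ j) ((f ^ j) v) = ((j ! : K) * m.descFactorial j) • v := by
    intro j
    induction j with
    | zero => simp
    | succ j ih =>
      intro hj
      rw [pow_succ e, Module.End.mul_apply, he, map_smul, ih (by omega), smul_smul,
        Nat.factorial_succ, Nat.descFactorial_succ]
      push_cast [Nat.cast_sub (show j ≤ m by omega)]
      congr 1
      ring
  rw [key m le_rfl, Nat.descFactorial_self]

end Operators

namespace D21

section Roots

variable {K : Type*} [Field K]

/-! ### The roots of `D(2,1;a)` -/

theorem cartan_eq_sum (H : cartan K) : H = ∑ i, (((H : Carrier K).1 i).1 0 0) • diagH K i := by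
  apply Subtype.ext
  obtain ⟨x, hx⟩ := H
  simp only [Submodule.coe_sum, Submodule.coe_smul, diagH]
  induction hx using Submodule.span_induction with
  | mem x hx =>
    obtain ⟨j, rfl⟩ := hx
    fin_cases j <;> simp [Fin.sum_univ_three, inEven, slH]
  | zero => simp
  | add x y _ _ hx hy =>
    conv_lhs => rw [hx, hy]
    rw [← Finset.sum_add_distrib]
    exact Finset.sum_congr rfl fun i _ => (add_smul _ _ _).symm
  | smul c x _ hx =>
    conv_lhs => rw [hx]
    rw [Finset.smul_sum]
    exact Finset.sum_congr rfl fun i _ => smul_smul _ _ _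

theorem dual_ext {α β : Module.Dual K (cartan K)} (h : ∀ i, α (diagH K i) = β (diagH K i)) :
    α = β := by
  ext H
  rw [cartan_eq_sum H]
  simp [h]

/-- The functional on `h` with prescribed values on `H_{2ε₁}, H_{2ε₂}, H_{2ε₃}`. -/
def wt (c : Fin 3 → K) : Module.Dual K (cartan K) where
  toFun x := ∑ i, c i * ((x : Carrier K).1 i).1 0 0
  map_add' x y := by
    rw [← Finset.sum_add_distrib]
    exact Finset.sum_congr rfl fun i _ => mul_add _ _ _
  map_smul' r x := by
    rw [RingHom.id_apply, smul_eq_mul, Finset.mul_sum]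
    exact Finset.sum_congr rfl fun i _ => mul_left_comm _ _ _

theorem wt_diagH (c : Fin 3 → K) (i : Fin 3) : wt c (diagH K i) = c i := by
  change ∑ j, c j * ((inEven i (slH K)).1 j).1 0 0 = c i
  rw [Finset.sum_eq_single i]
  · simp [inEven, slH]
  · intro j _ hj
    simp [inEven, hj]
  · simp

theorem bracket_diagH_fst (a : K) (i j : Fin 3) (x : Carrier K) :
    ((bracket a (diagH K i : Carrier K) x).1 j).1 0 0 = 0 ∧
    ((bracket a (diagH K i : Carrier K) x).1 j).1 0 1 =
      (if i = j then 2 else 0) * (x.1 j).1 0 1 ∧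
    ((bracket a (diagH K i : Carrier K) x).1 j).1 1 0 =
      -(if i = j then 2 else 0) * (x.1 j).1 1 0 := by
  have h : (bracket a (diagH K i : Carrier K) x).1 j =
      ⁅(Pi.single i (slH K) : Fin 3 → LieAlgebra.SpecialLinear.sl (Fin 2) K) j, x.1 j⁆ := by
    simp [bracket_apply, diagH, inEven, oddBracket_zero_left, evenBracket]
  rw [h]
  by_cases hij : i = j
  · subst hij
    simp only [Pi.single_eq_same, sl_lie_apply, slH, if_true]
    simp [sl_trace]
    constructor <;> ring
  · rw [Pi.single_eq_of_ne (Ne.symm hij), zero_lie]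
    simp [hij]

theorem bracket_diagH_snd (a : K) (i : Fin 3) (x : Carrier K) (p q r : Fin 2) :
    (bracket a (diagH K i : Carrier K) x).2 p q r =
      (if ![p, q, r] i = 0 then 1 else -1) * x.2 p q r := by
  have h : (bracket a (diagH K i : Carrier K) x).2 = act (inEven i (slH K)).1 x.2 := by
    simp [bracket_apply, diagH, inEven, act_zero_right]
  rw [h]
  simp only [act, Fin.sum_univ_two]
  fin_cases i <;> fin_cases p <;> fin_cases q <;> fin_cases r <;> simp [inEven, slH]

theorem mem_rootSpace_iff (a : K) (α : Module.Dual K (cartan K)) (x : Carrier K) :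
    x ∈ rootSpace a α ↔ ∀ i, bracket a (diagH K i : Carrier K) x = α (diagH K i) • x := by
  rw [mem_rootSpace]
  refine ⟨fun h i => h _, fun h H => ?_⟩
  rw [cartan_eq_sum H]
  simp [h, Finset.sum_smul, smul_smul]

theorem apply_diagH_of_fst_01 {a : K} {α : Module.Dual K (cartan K)} {x : Carrier K}
    (hx : x ∈ rootSpace a α) {j : Fin 3} (h : (x.1 j).1 0 1 ≠ 0) :
    α = wt (Pi.single j 2) := by
  refine dual_ext fun i => ?_
  have h1 := (bracket_diagH_fst a i j x).2.1
  rw [(mem_rootSpace_iff a α x).1 hx i] at h1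
  rw [wt_diagH, mul_right_cancel₀ h h1]
  simp [Pi.single_apply, eq_comm]

theorem apply_diagH_of_fst_10 {a : K} {α : Module.Dual K (cartan K)} {x : Carrier K}
    (hx : x ∈ rootSpace a α) {j : Fin 3} (h : (x.1 j).1 1 0 ≠ 0) :
    α = wt (Pi.single j (-2)) := by
  refine dual_ext fun i => ?_
  have h1 := (bracket_diagH_fst a i j x).2.2
  rw [(mem_rootSpace_iff a α x).1 hx i] at h1
  rw [wt_diagH, mul_right_cancel₀ h h1]
  by_cases hij : i = j
  · subst hij; simp
  · simp [hij]

theorem apply_diagH_of_fst_00 {a : K} {α : Module.Dual K (cartan K)} {x : Carrier K}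
    (hx : x ∈ rootSpace a α) {j : Fin 3} (h : (x.1 j).1 0 0 ≠ 0) : α = 0 := by
  refine dual_ext fun i => ?_
  have h1 := (bracket_diagH_fst a i j x).1
  rw [(mem_rootSpace_iff a α x).1 hx i] at h1
  exact (mul_eq_zero.1 h1).resolve_right h

theorem apply_diagH_of_snd {a : K} {α : Module.Dual K (cartan K)} {x : Carrier K}
    (hx : x ∈ rootSpace a α) {p q r : Fin 2} (h : x.2 p q r ≠ 0) :
    α = wt fun i => if ![p, q, r] i = 0 then 1 else -1 := by
  refine dual_ext fun i => ?_
  have h1 := bracket_diagH_snd a i x p q r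
  rw [(mem_rootSpace_iff a α x).1 hx i] at h1
  rw [wt_diagH, mul_right_cancel₀ h h1]

theorem exists_of_mem_evenRoots {a : K} {α : Module.Dual K (cartan K)} (h : α ∈ evenRoots a) :
    ∃ j, ∃ s : K, (s = 1 ∨ s = -1) ∧ α = wt (Pi.single j (2 * s)) := by
  obtain ⟨hα, hne⟩ := h
  obtain ⟨x, ⟨hx, hx0⟩, hxne⟩ := Submodule.exists_mem_ne_zero_of_ne_bot hne
  rw [SetLike.mem_coe, mem_part_zero] at hx0
  by_contra hcon
  push Not at hcon
  apply hxne
  refine Prod.ext (funext fun j => sl_ext ?_ ?_ ?_) hx0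
  · by_contra h0
    exact hα (apply_diagH_of_fst_00 hx h0)
  · by_contra h0
    exact hcon j 1 (Or.inl rfl) (by rw [mul_one]; exact apply_diagH_of_fst_01 hx h0)
  · by_contra h0
    exact hcon j (-1) (Or.inr rfl) (by rw [mul_neg_one]; exact apply_diagH_of_fst_10 hx h0)

theorem exists_of_mem_oddRoots {a : K} {α : Module.Dual K (cartan K)} (h : α ∈ oddRoots a) :
    ∃ s : Fin 3 → K, (∀ i, s i = 1 ∨ s i = -1) ∧ α = wt s := by
  obtain ⟨x, ⟨hx, hx1⟩, hxne⟩ := Submodule.exists_mem_ne_zero_of_ne_bot h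
  rw [SetLike.mem_coe, mem_part_one] at hx1
  by_contra hcon
  push Not at hcon
  apply hxne
  refine Prod.ext hx1 (funext fun p => funext fun q => funext fun r => ?_)
  by_contra h0
  refine hcon (fun i => if ![p, q, r] i = 0 then 1 else -1) (fun i => ?_)
    (apply_diagH_of_snd hx h0)
  split_ifs <;> simp

theorem wt_single_mem_evenRoots [CharZero K] (a : K) (j : Fin 3) {s : K} (hs : s = 1 ∨ s = -1) :
    wt (Pi.single j (2 * s)) ∈ evenRoots a := by
  refine ⟨fun h => ?_, ?_⟩
  · have := congrArg (fun α => α (diagH K j)) h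
    rcases hs with rfl | rfl <;> simp [wt_diagH] at this
  · have h2 : ∃ y : LieAlgebra.SpecialLinear.sl (Fin 2) K, ⁅slH K, y⁆ = (2 * s) • y ∧ y ≠ 0 := by
      rcases hs with rfl | rfl
      · refine ⟨slE K, by rw [slH_E, mul_one], fun h => ?_⟩
        simpa [slE] using congrArg (fun y => y.1 0 1) h
      · refine ⟨slF K, by rw [slH_F, mul_neg_one, neg_smul], fun h => ?_⟩
        simpa [slF] using congrArg (fun y => y.1 1 0) h
    obtain ⟨y, hy, hy0⟩ := h2
    refine (Submodule.ne_bot_iff _).2 ⟨inEven j y, ⟨?_, mem_part_zero.2 rfl⟩, fun h => hy0 ?_⟩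
    · rw [SetLike.mem_coe, mem_rootSpace_iff]
      intro i
      rw [wt_diagH]
      change bracket a (inEven i (slH K)) (inEven j y) = _
      rw [bracket_even]
      by_cases hij : i = j
      · subst hij
        simp [hy, inEven_smul]
      · simp [hij]
    · simpa [inEven] using congrArg (fun x : Carrier K => x.1 j) h

theorem wt_mem_oddRoots (a : K) {s : Fin 3 → K} (hs : ∀ i, s i = 1 ∨ s i = -1) :
    wt s ∈ oddRoots a := by
  classical
  have ht : ∀ i, ∃ t : Fin 2, s i = if t = 0 then 1 else -1 := by
    intro i
    rcases hs i with h | h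
    exacts [⟨0, by simp [h]⟩, ⟨1, by simp [h]⟩]
  choose t ht using ht
  refine (Submodule.ne_bot_iff _).2 ⟨inOdd K (t 0) (t 1) (t 2), ⟨?_, mem_part_one.2 rfl⟩, ?_⟩
  · rw [SetLike.mem_coe, mem_rootSpace_iff]
    intro i
    refine Prod.ext ?_ (funext fun p => funext fun q => funext fun r => ?_)
    · simp [bracket_apply, inOdd, diagH, inEven, evenBracket_zero_right, oddBracket_zero_left]
    · rw [bracket_diagH_snd, wt_diagH, ht]
      simp only [inOdd, Prod.smul_mk, Pi.smul_apply, smul_eq_mul]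
      by_cases h : p = t 0 ∧ q = t 1 ∧ r = t 2
      · obtain ⟨rfl, rfl, rfl⟩ := h
        congr 2
        fin_cases i <;> rfl
      · simp [h]
  · intro h
    simpa [inOdd] using congrArg (fun x : Carrier K => x.2 (t 0) (t 1) (t 2)) h

theorem neg_wt (c : Fin 3 → K) : -wt c = wt (-c) := dual_ext fun i => by simp [wt_diagH]

theorem wt_add (c d : Fin 3 → K) : wt c + wt d = wt (c + d) :=
  dual_ext fun i => by simp [wt_diagH]

theorem neg_mem_evenRoots [CharZero K] {a : K} {α : Module.Dual K (cartan K)}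
    (h : α ∈ evenRoots a) : -α ∈ evenRoots a := by
  obtain ⟨j, s, hs, rfl⟩ := exists_of_mem_evenRoots h
  rw [neg_wt, ← Pi.single_neg, ← mul_neg]
  exact wt_single_mem_evenRoots a j (by rcases hs with rfl | rfl <;> simp)

theorem not_mem_oddRoots_of_mem_evenRoots [CharZero K] {a : K} {α : Module.Dual K (cartan K)}
    (h : α ∈ evenRoots a) : α ∉ oddRoots a := by
  intro h'
  obtain ⟨j, s, hs, rfl⟩ := exists_of_mem_evenRoots h
  obtain ⟨t, ht, h⟩ := exists_of_mem_oddRoots h'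
  have := congrArg (fun α => α (diagH K (j + 1))) h
  have hj : j + 1 ≠ j := by fin_cases j <;> decide
  rcases ht (j + 1) with h1 | h1 <;> simp [wt_diagH, h1, hj] at this

theorem ne_zero_of_mem_roots [CharZero K] {a : K} {α : Module.Dual K (cartan K)}
    (h : α ∈ roots a) : α ≠ 0 := by
  rcases h with h | h
  · exact h.1
  · rintro rfl
    obtain ⟨t, ht, h⟩ := exists_of_mem_oddRoots h
    have := congrArg (fun α => α (diagH K 0)) h
    rcases ht 0 with h1 | h1 <;> simp [wt_diagH, h1] at this

/-- A Chevalley basis is only assumed homogeneous. The parity of `X_α` is determined by `α` because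
even and odd roots are disjoint. -/
theorem mem_part_zero_of_mem_rootSpace [CharZero K] {a : K} {α : Module.Dual K (cartan K)}
    (h : α ∈ evenRoots a) {x : Carrier K} (hx : x ∈ rootSpace a α) : x ∈ part K 0 := by
  rw [mem_part_zero]
  funext p q r
  by_contra h0
  refine not_mem_oddRoots_of_mem_evenRoots h ?_
  rw [apply_diagH_of_snd hx h0]
  exact wt_mem_oddRoots a fun i => by split_ifs <;> simp

theorem mem_part_one_of_mem_rootSpace [CharZero K] {a : K} {α : Module.Dual K (cartan K)}
    (h : α ∈ oddRoots a) {x : Carrier K} (hx : x ∈ rootSpace a α) : x ∈ part K 1 := by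
  rw [mem_part_one]
  refine funext fun j => sl_ext ?_ ?_ ?_
  · by_contra h0
    exact ne_zero_of_mem_roots (Or.inr h) (apply_diagH_of_fst_00 hx h0)
  · by_contra h0
    refine not_mem_oddRoots_of_mem_evenRoots ?_ h
    rw [apply_diagH_of_fst_01 hx h0, ← mul_one (2 : K)]
    exact wt_single_mem_evenRoots a j (Or.inl rfl)
  · by_contra h0
    refine not_mem_oddRoots_of_mem_evenRoots ?_ h
    rw [apply_diagH_of_fst_10 hx h0, ← mul_neg_one (2 : K)]
    exact wt_single_mem_evenRoots a j (Or.inr rfl)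

theorem sigma_ne_zero [CharZero K] {a : K} (ha₀ : a ≠ 0) (ha₁ : a ≠ -1) (i : Fin 3) :
    sigma a i ≠ 0 := by
  have h : 1 + a ≠ 0 := fun h => ha₁ (by linear_combination h)
  fin_cases i
  · simpa [sigma, neg_add_eq_zero, neg_eq_iff_eq_neg, add_comm] using neg_ne_zero.2 h
  · simp [sigma]
  · simpa [sigma] using ha₀

/-- The scalar `σ_j` cancels in the coroot `2 t_α / (α, α)`; it is nonzero because `a ≠ 0, -1`.
Integrality of a weight on even coroots thus becomes integrality on the `H_{2ε_j}`. -/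
theorem coroot_wt_single [CharZero K] {a : K} (ha₀ : a ≠ 0) (ha₁ : a ≠ -1) (j : Fin 3) {s : K}
    (hs : s = 1 ∨ s = -1) : coroot a (wt (Pi.single j (2 * s))) = s • diagH K j := by
  have hσ := sigma_ne_zero ha₀ ha₁ j
  have hform : form a (wt (Pi.single j (2 * s))) (wt (Pi.single j (2 * s))) = 4 * sigma a j := by
    rw [form, Finset.sum_eq_single j]
    · rcases hs with rfl | rfl <;> simp [wt_diagH] <;> ring
    · intro i _ hi
      simp [wt_diagH, hi]
    · simp
  have hdual : dualVector a (wt (Pi.single j (2 * s))) = (2 * s * sigma a j) • diagH K j := by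
    rw [dualVector, Finset.sum_eq_single j]
    · simp [wt_diagH, mul_comm]
    · intro i _ hi
      simp [wt_diagH, hi]
    · simp
  rw [coroot, hform, if_neg (mul_ne_zero (OfNat.ofNat_ne_zero 4) hσ), hdual, smul_smul]
  congr 1
  field_simp
  norm_num

theorem apply_coroot_self [CharZero K] {a : K} (ha₀ : a ≠ 0) (ha₁ : a ≠ -1)
    {α : Module.Dual K (cartan K)} (h : α ∈ evenRoots a) : α (coroot a α) = 2 := by
  obtain ⟨j, s, hs, rfl⟩ := exists_of_mem_evenRoots h
  rw [coroot_wt_single ha₀ ha₁ j hs, map_smul, wt_diagH]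
  rcases hs with rfl | rfl <;> simp

theorem form_wt (a : K) (c d : Fin 3 → K) : form a (wt c) (wt d) = ∑ i, sigma a i * c i * d i := by
  simp [form, wt_diagH]

/-- The coordinates are `±1` and the three scalars `σ_i` sum to zero. -/
theorem form_self_of_mem_oddRoots [CharZero K] {a : K} {α : Module.Dual K (cartan K)}
    (h : α ∈ oddRoots a) : form a α α = 0 := by
  obtain ⟨s, hs, rfl⟩ := exists_of_mem_oddRoots h
  have hs2 : ∀ i, s i * s i = 1 := fun i => by rcases hs i with h | h <;> simp [h]
  simp only [form_wt, mul_assoc, hs2, Fin.sum_univ_three, sigma]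
  simp
  ring

/-- For each odd root `α` there is an odd root `β` with `α + β` an even root and
`β(H_α) = -1`. -/
theorem exists_oddRoot_add_mem_evenRoots [CharZero K] {a : K} {α : Module.Dual K (cartan K)}
    (h : α ∈ oddRoots a) :
    ∃ β ∈ oddRoots a, α + β ∈ evenRoots a ∧ β (coroot a α) = -1 := by
  have h0 := form_self_of_mem_oddRoots h
  obtain ⟨s, hs, rfl⟩ := exists_of_mem_oddRoots h
  have hs2 : ∀ i, s i * s i = 1 := fun i => by rcases hs i with h | h <;> simp [h]
  -- Only the middle sign is kept, so the sum is `±2ε₂` and `(α, β) = -σ₀ + σ₁ - σ₂ = 2 σ₁ = 1`.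
  -- Keeping another sign would give `-(1 + a)` or `a`, which need not be invertible in `ℤ_a`.
  refine ⟨wt ![-s 0, s 1, -s 2], wt_mem_oddRoots a ?_, ?_, ?_⟩
  · intro i
    fin_cases i
    · rcases hs 0 with h | h <;> simp [h]
    · exact hs 1
    · rcases hs 2 with h | h <;> simp [h]
  · rw [wt_add]
    convert wt_single_mem_evenRoots a 1 (hs 1) using 2
    funext i
    fin_cases i <;> simp; ring
  · rw [coroot, if_pos h0, map_neg, apply_dualVector, form_wt]
    simp only [Fin.sum_univ_three, Matrix.cons_val, mul_neg, mul_assoc, hs2, sigma]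
    field_simp
    ring

end Roots

end D21

theorem smul_mem_latticeEnd {K V : Type*} [Field K] [AddCommGroup V] [Module K V] {R : Subring K}
    {M : Submodule R V} {c : K} (hc : c ∈ R) {T : Module.End K V} (hT : T ∈ latticeEnd M) :
    c • T ∈ latticeEnd M := by
  intro m hm
  simpa [Subring.smul_def] using M.smul_mem ⟨c, hc⟩ (hT m hm)

namespace D21

section Lattice

variable {K : Type*} [Field K] [CharZero K] {a : K} {V : Type*} [AddCommGroup V] [Module K V]

/-! ### Chevalley bases -/

/-- Makes the binomial coefficients of `H_{2ε_i}` elements of the Kostant superalgebra, whichever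
basis `H₁, H₂, H₃` was chosen. -/
theorem diagH_mem_span (ha₀ : a ≠ 0) (ha₁ : a ≠ -1) (B : ChevalleyBasis a) (i : Fin 3) :
    diagH K i ∈ Submodule.span (intAdjoin a) (Set.range B.H) := by
  rw [B.span_coroots]
  refine Submodule.subset_span
    ⟨_, Or.inl (wt_single_mem_evenRoots a i (s := 1) (Or.inl rfl)), ?_⟩
  rw [coroot_wt_single ha₀ ha₁ i (Or.inl rfl), one_smul]

omit [CharZero K] in
theorem ChevalleyBasis.X_mem_rootSpace (B : ChevalleyBasis a) (α : roots a) :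
    B.X α ∈ rootSpace a α.1 := by
  rw [mem_rootSpace]
  intro H
  have hH : H ∈ Submodule.span K (Set.range B.H) := B.span_H ▸ Submodule.mem_top
  induction hH using Submodule.span_induction with
  | mem x hx =>
    obtain ⟨i, rfl⟩ := hx
    exact B.bracket_H_X i α
  | zero => simp
  | add x y _ _ hx hy => simp [hx, hy, add_smul]
  | smul c x _ hx => simp [hx, smul_smul]

theorem ChevalleyBasis.X_mem_part_zero (B : ChevalleyBasis a) {α : roots a}
    (h : α.1 ∈ evenRoots a) : B.X α ∈ part K 0 :=
  mem_part_zero_of_mem_rootSpace h (B.X_mem_rootSpace α)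

theorem ChevalleyBasis.X_mem_part_one (B : ChevalleyBasis a) {α : roots a}
    (h : α.1 ∈ oddRoots a) : B.X α ∈ part K 1 :=
  mem_part_one_of_mem_rootSpace h (B.X_mem_rootSpace α)

omit [CharZero K] in
theorem cartan_le_part_zero (H : cartan K) : (H : Carrier K) ∈ part K 0 := by
  refine (Submodule.span_le.2 ?_ : cartan K ≤ part K 0) H.2
  rintro _ ⟨i, rfl⟩
  exact mem_part_zero.2 rfl

/-! ### The action on the weight spaces -/

variable (ρ : LieSuperalgebra.Rep (algebra a) V)

theorem toHom_bracket_even {x y : Carrier K} (hx : x ∈ part K 0) {j : ZMod 2}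
    (hy : y ∈ part K j) :
    ρ.toHom (bracket a x y) = ρ.toHom x * ρ.toHom y - ρ.toHom y * ρ.toHom x := by
  have h : ρ.toHom (bracket a x y) = _ := ρ.map_bracket 0 j x hx y hy
  simpa [superSign] using h

theorem toHom_bracket_odd {x y : Carrier K} (hx : x ∈ part K 1) (hy : y ∈ part K 1) :
    ρ.toHom (bracket a x y) = ρ.toHom x * ρ.toHom y + ρ.toHom y * ρ.toHom x := by
  have h : ρ.toHom (bracket a x y) = _ := ρ.map_bracket 1 1 x hx y hy
  simpa [superSign] using h

theorem toHom_mem_weightSpace {α μ : Module.Dual K (cartan K)} {j : ZMod 2} {x : Carrier K}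
    (hx : x ∈ rootSpace a α) (hj : x ∈ part K j) {v : V} (hv : v ∈ weightSpace ρ μ) :
    ρ.toHom x v ∈ weightSpace ρ (μ + α) := by
  rw [mem_weightSpace] at hv ⊢
  intro H
  have h := LinearMap.congr_fun (toHom_bracket_even ρ (cartan_le_part_zero H) hj) v
  rw [(mem_rootSpace a α x).1 hx H] at h
  simp only [map_smul, LinearMap.smul_apply, LinearMap.sub_apply, Module.End.mul_apply, hv] at h
  rw [eq_sub_iff_add_eq.1 h |>.symm, LinearMap.add_apply, add_smul, add_comm]

variable {ρ}

theorem end_ext_of_weightSpace (hρ : ⨆ μ, weightSpace ρ μ = ⊤) {S T : Module.End K V}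
    (h : ∀ μ ∈ weights ρ, ∀ v ∈ weightSpace ρ μ, S v = T v) : S = T := by
  ext v
  have hv : v ∈ ⨆ μ, weightSpace ρ μ := hρ ▸ Submodule.mem_top
  induction hv using Submodule.iSup_induction' with
  | mem μ v hv =>
    by_cases hμ : μ ∈ weights ρ
    · exact h μ hμ v hv
    · rw [weights, Set.mem_ofPred_eq, not_not] at hμ
      rw [hμ, Submodule.mem_bot] at hv
      simp [hv]
  | zero => simp
  | add x y _ _ hx hy => simp [hx, hy]

/-- A weight is determined by its values on the three `H_{2ε_i}`, and these are eigenvalues of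
operators on a finite dimensional space. -/
theorem finite_weights [FiniteDimensional K V] (ρ : LieSuperalgebra.Rep (algebra a) V) :
    (weights ρ).Finite := by
  refine Set.Finite.of_finite_image (f := fun μ i => μ (diagH K i)) ?_ ?_
  · refine (Set.Finite.pi' (t := fun i => {c | Module.End.HasEigenvalue
      (ρ.toHom (diagH K i : Carrier K)) c}) fun i => Module.End.finite_hasEigenvalue _).subset ?_
    rintro _ ⟨μ, hμ, rfl⟩ i
    obtain ⟨v, hv, hv0⟩ := Submodule.exists_mem_ne_zero_of_ne_bot hμ
    exact Module.End.hasEigenvalue_of_hasEigenvector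
      ⟨Module.End.mem_eigenspace_iff.2 ((mem_weightSpace ρ μ v).1 hv _), hv0⟩
  · intro μ _ ν _ h
    exact dual_ext fun i => congrFun h i

/-! ### Admissible lattices and weight projections -/

variable {B : ChevalleyBasis a}

theorem exists_int_apply_diagH (ha₀ : a ≠ 0) (ha₁ : a ≠ -1) (hρ : IsRational B ρ)
    {μ : Module.Dual K (cartan K)} (hμ : μ ∈ weights ρ) (i : Fin 3) :
    ∃ n : ℤ, μ (diagH K i) = n := by
  have h := hρ.apply_coroot μ hμ _ (wt_single_mem_evenRoots a i (s := 1) (Or.inl rfl))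
  rwa [coroot_wt_single ha₀ ha₁ i (Or.inl rfl), one_smul] at h

variable {M : Submodule (binomRing a) V}

theorem IsAdmissible.envAction_mem (hM : IsAdmissible B ρ M)
    {u : LieSuperalgebra.Env (algebra a)} (hu : u ∈ kostant B) : ρ.envAction u ∈ latticeEnd M :=
  hM.stable u hu

theorem IsAdmissible.binomCoeff_mem (hM : IsAdmissible B ρ M) {H : cartan K}
    (hH : H ∈ Submodule.span (intAdjoin a) (Set.range B.H)) (n : ℕ) :
    binomCoeff K (ρ.toHom (H : Carrier K)) n ∈ latticeEnd M := by
  rw [← ρ.envAction_of, ← map_binomCoeff]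
  exact hM.envAction_mem (Algebra.subset_adjoin (Or.inr ⟨H, hH, n, rfl⟩))

theorem IsAdmissible.dividedPow_mem (hM : IsAdmissible B ρ M) {α : roots a}
    (hα : α.1 ∈ evenRoots a) (n : ℕ) : dividedPow K (ρ.toHom (B.X α)) n ∈ latticeEnd M := by
  rw [← ρ.envAction_of, ← map_dividedPow]
  exact hM.envAction_mem (Algebra.subset_adjoin (Or.inl (Or.inl ⟨α, hα, n, rfl⟩)))

theorem IsAdmissible.toHom_X_mem (hM : IsAdmissible B ρ M) (α : roots a) :
    ρ.toHom (B.X α) ∈ latticeEnd M := by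
  rcases α.2 with hα | hα
  · simpa [dividedPow] using hM.dividedPow_mem hα 1
  · rw [← ρ.envAction_of]
    exact hM.envAction_mem (Algebra.subset_adjoin (Or.inl (Or.inr ⟨α, hα, rfl⟩)))

/-- The projection of `V` to a weight space preserves every admissible lattice. -/
theorem exists_weight_projection [FiniteDimensional K V] (ha₀ : a ≠ 0) (ha₁ : a ≠ -1)
    (hρ : IsRational B ρ) (hM : IsAdmissible B ρ M) (μ : Module.Dual K (cartan K)) :
    ∃ e ∈ latticeEnd M, (∀ v ∈ weightSpace ρ μ, e v = v) ∧
      ∀ ν, ν ≠ μ → ∀ v ∈ weightSpace ρ ν, e v = 0 := by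
  have hbot : ∀ ν, ν ∉ weights ρ → ∀ v ∈ weightSpace ρ ν, v = 0 := by
    intro ν hν v hv
    rw [weights, Set.mem_ofPred_eq, not_not] at hν
    rwa [hν, Submodule.mem_bot] at hv
  by_cases hμ : μ ∈ weights ρ
  swap
  -- Functionals that are not weights are allowed, since a shifted weight `μ + β` may fail to be
  -- one.
  · exact ⟨0, zero_mem _, fun v hv => by simp [hbot μ hμ v hv], by simp⟩
  choose! n hn using fun ν (hν : ν ∈ weights ρ) (i : Fin 3) =>
    exists_int_apply_diagH ha₀ ha₁ hρ hν i
  -- One window size for all weights, as each indicator operator is controlled only up to distance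
  -- `N`.
  obtain ⟨N, hN⟩ : ∃ N : ℕ, ∀ ν ∈ weights ρ, ∀ i, |n ν i - n μ i| ≤ N := by
    obtain ⟨N, hN⟩ := ((finite_weights ρ).image
      fun ν => ∑ i, (n ν i - n μ i).natAbs).bddAbove
    refine ⟨N, fun ν hν i => ?_⟩
    have h1 := hN ⟨ν, hν, rfl⟩
    have h2 := Finset.single_le_sum (f := fun i => (n ν i - n μ i).natAbs)
      (fun _ _ => Nat.zero_le _) (Finset.mem_univ i)
    simp only at h1 h2
    rw [Int.abs_eq_natAbs]
    omega
  let T : Fin 3 → Module.End K V := fun i => ρ.toHom (diagH K i : Carrier K)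
  have hT : ∀ i, indicatorOp (T i) (n μ i) N ∈ latticeEnd M := by
    intro i
    refine indicatorOp_mem (hM.binomCoeff_mem (diagH_mem_span ha₀ ha₁ B i)) (fun k => ?_) _ _
    have := hM.binomCoeff_mem (neg_mem (diagH_mem_span ha₀ ha₁ B i)) k
    simpa [T] using this
  have hact : ∀ i, ∀ ν ∈ weights ρ, ∀ v ∈ weightSpace ρ ν, indicatorOp (T i) (n μ i) N v =
      if n ν i = n μ i then v else 0 := by
    intro i ν hν v hv
    refine indicatorOp_apply ?_ (hN ν hν i)
    rw [← hn ν hν i]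
    exact (mem_weightSpace ρ ν v).1 hv _
  refine ⟨indicatorOp (T 0) (n μ 0) N * indicatorOp (T 1) (n μ 1) N *
    indicatorOp (T 2) (n μ 2) N, mul_mem (mul_mem (hT 0) (hT 1)) (hT 2), ?_, ?_⟩
  · intro v hv
    simp [hact _ μ hμ v hv]
  · intro ν hνμ v hv
    by_cases hν : ν ∈ weights ρ
    swap
    · simp [hbot ν hν v hv]
    simp only [Module.End.mul_apply, hact 2 ν hν v hv]
    split_ifs with h2
    swap
    · simp
    rw [hact 1 ν hν v hv]
    split_ifs with h1
    swap
    · simp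
    rw [hact 0 ν hν v hv]
    split_ifs with h0
    swap
    · rfl
    exfalso
    apply hνμ
    refine dual_ext fun i => ?_
    rw [hn ν hν, hn μ hμ]
    fin_cases i
    · exact congrArg _ h0
    · exact congrArg _ h1
    · exact congrArg _ h2

/-- The homogeneous components of an operator that preserves an admissible lattice preserve it. -/
theorem component_mem_latticeEnd [FiniteDimensional K V] (ha₀ : a ≠ 0) (ha₁ : a ≠ -1)
    (hρ : IsRational B ρ) (hM : IsAdmissible B ρ M) {ι : Type*} [Fintype ι]
    {Z : ι → Module.End K V} {β : ι → Module.Dual K (cartan K)} (hβ : Function.Injective β)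
    (hZ : ∀ i μ, ∀ v ∈ weightSpace ρ μ, Z i v ∈ weightSpace ρ (μ + β i))
    (h : ∑ i, Z i ∈ latticeEnd M) (i : ι) : Z i ∈ latticeEnd M := by
  classical
  choose e heM he he' using exists_weight_projection ha₀ ha₁ hρ hM
  -- On `V_μ` the summands `Z j` land in the weight spaces of `μ + β j`, which are distinct because
  -- `β` is injective; `e (μ + β i)` keeps exactly the one with `j = i`.
  have key : Z i = ∑ μ ∈ (finite_weights ρ).toFinset, e (μ + β i) * (∑ j, Z j) * e μ := by
    refine end_ext_of_weightSpace hρ.iSup_weightSpace fun ν hν v hv => ?_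
    rw [LinearMap.sum_apply, Finset.sum_eq_single ν]
    · rw [Module.End.mul_apply, Module.End.mul_apply, he ν v hv, LinearMap.sum_apply, map_sum,
        Finset.sum_eq_single i]
      · rw [he _ _ (hZ i ν v hv)]
      · intro j _ hj
        exact he' _ _ (fun h => hj (hβ (add_left_cancel h))) _ (hZ j ν v hv)
      · simp
    · intro μ _ hμ
      rw [Module.End.mul_apply, he' μ ν (Ne.symm hμ) v hv, map_zero]
    · simp [hν]
  rw [key]
  exact sum_mem fun μ _ => mul_mem (mul_mem (heM _) h) (heM _)

/-- With `e` the projection to `V_μ`, the hypothesis says `T e = c e`, so `e` and `c e` both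
preserve `M`; moreover `e ≠ 0` since `μ` is a weight. -/
theorem mem_binomRing_of_apply_eq_smul [FiniteDimensional K V] (ha₀ : a ≠ 0) (ha₁ : a ≠ -1)
    (hρ : IsRational B ρ) (hM : IsAdmissible B ρ M) {μ : Module.Dual K (cartan K)}
    (hμ : μ ∈ weights ρ) {T : Module.End K V} (hT : T ∈ latticeEnd M) {c : K}
    (h : ∀ v ∈ weightSpace ρ μ, T v = c • v) : c ∈ binomRing a := by
  obtain ⟨e, heM, he, he'⟩ := exists_weight_projection ha₀ ha₁ hρ hM μ
  refine mem_of_smul_idempotent hM.isLattice (e := e) ?_ ?_ heM ?_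
  · refine end_ext_of_weightSpace hρ.iSup_weightSpace fun ν _ v hv => ?_
    by_cases hν : ν = μ
    · subst hν
      rw [Module.End.mul_apply, he v hv, he v hv]
    · rw [Module.End.mul_apply, he' ν hν v hv, map_zero]
  · obtain ⟨v, hv, hv0⟩ := Submodule.exists_mem_ne_zero_of_ne_bot hμ
    intro h0
    exact hv0 (by rw [← he v hv, h0, LinearMap.zero_apply])
  · have : T * e = c • e := by
      refine end_ext_of_weightSpace hρ.iSup_weightSpace fun ν _ v hv => ?_
      by_cases hν : ν = μ
      · subst hν
        rw [Module.End.mul_apply, he v hv, h v hv, LinearMap.smul_apply, he v hv]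
      · rw [Module.End.mul_apply, LinearMap.smul_apply, he' ν hν v hv, map_zero, smul_zero]
    exact fun m hm => by simpa [this] using (mul_mem hT heM) m hm

/-- An element `H` of the Cartan subalgebra preserves an admissible lattice if and only if
`μ(H) ∈ ℤ_a` for all weights `μ`. -/
theorem toHom_cartan_mem_latticeEnd_iff [FiniteDimensional K V] (ha₀ : a ≠ 0) (ha₁ : a ≠ -1)
    (hρ : IsRational B ρ) (hM : IsAdmissible B ρ M) (H : cartan K) :
    ρ.toHom (H : Carrier K) ∈ latticeEnd M ↔ ∀ μ ∈ weights ρ, μ H ∈ binomRing a := by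
  constructor
  · intro h μ hμ
    exact mem_binomRing_of_apply_eq_smul ha₀ ha₁ hρ hM hμ h fun v hv =>
      (mem_weightSpace ρ μ v).1 hv H
  · intro h
    classical
    choose e heM he he' using exists_weight_projection ha₀ ha₁ hρ hM
    have key : ρ.toHom (H : Carrier K) =
        ∑ μ ∈ (finite_weights ρ).toFinset, μ H • e μ := by
      refine end_ext_of_weightSpace hρ.iSup_weightSpace fun ν hν v hv => ?_
      rw [LinearMap.sum_apply, Finset.sum_eq_single ν, LinearMap.smul_apply, he ν v hv,
        (mem_weightSpace ρ ν v).1 hv]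
      · intro μ _ hμ
        rw [LinearMap.smul_apply, he' μ ν (Ne.symm hμ) v hv, smul_zero]
      · simp [hν]
    rw [key]
    exact sum_mem fun μ hμ => smul_mem_latticeEnd (h μ (by simpa using hμ)) (heM μ)

/-! ### Integrality of the coefficients of root vectors -/

theorem exists_weight_apply_ne_zero (hfaithful : Function.Injective ρ.toHom)
    (hρ : ⨆ μ, weightSpace ρ μ = ⊤) {H : cartan K} (hH : H ≠ 0) : ∃ μ ∈ weights ρ, μ H ≠ 0 := by
  by_contra hcon
  push Not at hcon
  apply hH
  apply Subtype.ext
  apply hfaithful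
  rw [ZeroMemClass.coe_zero, map_zero]
  refine end_ext_of_weightSpace hρ fun μ hμ v hv => ?_
  rw [(mem_weightSpace ρ μ v).1 hv, hcon μ hμ, zero_smul, LinearMap.zero_apply]

/-- The `sl₂`-triple of `α` is evaluated on a weight at the end of a longest string. It gives `c m ∈
ℤ_a` and `c ^ m m! ∈ ℤ_a` for the same `m > 0`, and these together force `c ∈ ℤ_a`. -/
theorem mem_binomRing_of_smul_even [FiniteDimensional K V] (ha₀ : a ≠ 0) (ha₁ : a ≠ -1)
    (hfaithful : Function.Injective ρ.toHom) (hρ : IsRational B ρ) (hM : IsAdmissible B ρ M)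
    {α : roots a} (hα : α.1 ∈ evenRoots a) {c : K}
    (hc : c • ρ.toHom (B.X α) ∈ latticeEnd M) : c ∈ binomRing a := by
  have hnα := neg_mem_evenRoots hα
  let α' : roots a := ⟨-α.1, Or.inl hnα⟩
  have hα' : α'.1 ∈ evenRoots a := hnα
  set e := ρ.toHom (B.X α) with he
  set f := ρ.toHom (B.X α') with hf
  set h := ρ.toHom (coroot a α.1 : Carrier K) with hh
  have hpos : ∀ {μ v}, v ∈ weightSpace ρ μ → e v ∈ weightSpace ρ (μ + α.1) := fun hv =>
    toHom_mem_weightSpace ρ (B.X_mem_rootSpace α) (B.X_mem_part_zero hα) hv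
  have hneg : ∀ {μ v}, v ∈ weightSpace ρ μ → f v ∈ weightSpace ρ (μ + α'.1) := fun hv =>
    toHom_mem_weightSpace ρ (B.X_mem_rootSpace α') (B.X_mem_part_zero hα') hv
  have h2 : α.1 (coroot a α.1) = 2 := apply_coroot_self ha₀ ha₁ hα
  have h2' : α'.1 (coroot a α.1) = -2 := by simp [α', h2]
  have hef : e * f - f * e = h := by
    rw [he, hf, ← toHom_bracket_even ρ (B.X_mem_part_zero hα) (B.X_mem_part_zero hα'),
      B.bracket_X_neg α α' rfl fun hcon => not_mem_oddRoots_of_mem_evenRoots hα hcon.1]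
  have hhe : h * e - e * h = (2 : K) • e := by
    rw [he, hh, ← toHom_bracket_even ρ (cartan_le_part_zero _) (B.X_mem_part_zero hα),
      (mem_rootSpace a _ _).1 (B.X_mem_rootSpace α), h2, map_smul]
  have hhf : h * f - f * h = -(2 : K) • f := by
    rw [hf, hh, ← toHom_bracket_even ρ (cartan_le_part_zero _) (B.X_mem_part_zero hα'),
      (mem_rootSpace a _ _).1 (B.X_mem_rootSpace α'), h2', map_smul]
  choose! n hn using fun μ (hμ : μ ∈ weights ρ) => hρ.apply_coroot μ hμ α.1 hα
  obtain ⟨μ₀, hμ₀, hne⟩ := exists_weight_apply_ne_zero hfaithful hρ.iSup_weightSpace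
    (H := coroot a α.1) (by intro h0; rw [h0, map_zero] at h2; exact two_ne_zero h2.symm)
  -- The absolute value is maximized, so `μ(H_α)` may have either sign; `μ₀` ensures that the
  -- maximum is positive.
  obtain ⟨μ, hμ, hmax⟩ := Set.exists_max_image (weights ρ) (fun μ => (n μ).natAbs)
    (finite_weights ρ) ⟨μ₀, hμ₀⟩
  have hm0 : (n μ).natAbs ≠ 0 := by
    have h1 := hmax μ₀ hμ₀
    have h3 : n μ₀ ≠ 0 := by
      intro h0
      rw [hn μ₀ hμ₀, h0, Int.cast_zero] at hne
      exact hne rfl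
    omega
  -- A nonzero vector of weight `μ + δ` would contradict maximality. This is used with `d = ±2`, in
  -- the direction that moves away from zero.
  have hvanish : ∀ {δ : Module.Dual K (cartan K)} {d : ℤ} {w : V}, δ (coroot a α.1) = d →
      (n μ).natAbs < (n μ + d).natAbs → w ∈ weightSpace ρ (μ + δ) → w = 0 := by
    intro δ d w hδ hd hw
    by_contra hw0
    have hmem : μ + δ ∈ weights ρ := (Submodule.ne_bot_iff _).2 ⟨w, hw, hw0⟩
    have h1 := hn _ hmem
    rw [LinearMap.add_apply, hn μ hμ, hδ, ← Int.cast_add, Int.cast_inj] at h1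
    have h3 := hmax _ hmem
    omega
  have hfM : f ∈ latticeEnd M := hM.toHom_X_mem α'
  -- The commutator of `c X_α` with `X_{-α}` is `c H_α`.
  have hhM : c • h ∈ latticeEnd M := by
    have : c • h = (c • e) * f - f * (c • e) := by
      rw [← hef, smul_sub, smul_mul_assoc, mul_smul_comm]
    rw [this]
    exact sub_mem (mul_mem hc hfM) (mul_mem hfM hc)
  have hcn : c * n μ ∈ binomRing a := by
    refine mem_binomRing_of_apply_eq_smul ha₀ ha₁ hρ hM hμ hhM fun v hv => ?_
    rw [LinearMap.smul_apply, hh, (mem_weightSpace ρ μ v).1 hv, hn μ hμ, smul_smul]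
  have hfac : (((n μ).natAbs)! : K) ≠ 0 := Nat.cast_ne_zero.2 (Nat.factorial_ne_zero _)
  have hdiv := hM.dividedPow_mem hα' (n μ).natAbs
  have hweight : ∀ v ∈ weightSpace ρ μ, h v = (n μ : K) • v := fun v hv => by
    rw [hh, (mem_weightSpace ρ μ v).1 hv, hn μ hμ]
  have hsmul : ∀ v : V, (c ^ (n μ).natAbs * ((((n μ).natAbs)! : K)⁻¹ *
      (((n μ).natAbs)! * ((n μ).natAbs)!))) • v =
        (c ^ (n μ).natAbs * ((n μ).natAbs)!) • v := fun v => by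
    rw [inv_mul_cancel_left₀ hfac]
  refine mem_of_mul_mem_of_pow_mul_factorial_mem a hm0 ?_ ?_
  · rcases Int.natAbs_eq (n μ) with h1 | h1
    · rw [h1] at hcn
      simpa using hcn
    · rw [h1] at hcn
      simpa using hcn
  -- If `μ(H_α) > 0`, vectors of `V_μ` are primitive for `(e, f, h)` and `(c e) ^ m` follows `f ^ m
  -- / m!`. If it is negative, they are primitive for `(f, e, -h)` and the order is reversed. Both
  -- products act by `c ^ m m!`.
  · rcases Int.natAbs_eq (n μ) with h1 | h1
    · refine mem_binomRing_of_apply_eq_smul ha₀ ha₁ hρ hM hμ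
        (mul_mem (pow_mem hc (n μ).natAbs) hdiv) fun v hv => ?_
      have hev : e v = 0 := hvanish (d := 2) (by simpa using h2) (by omega) (hpos hv)
      have := pow_mul_pow_apply_of_primitive hef hhf (m := (n μ).natAbs)
        (by rw [hweight v hv]; nth_rewrite 1 [h1]; simp) hev
      rw [Module.End.mul_apply, dividedPow, LinearMap.smul_apply, map_smul, smul_pow,
        LinearMap.smul_apply, this, smul_smul, smul_smul, ← hsmul]
      congr 1
      ring
    · refine mem_binomRing_of_apply_eq_smul ha₀ ha₁ hρ hM hμ
        (mul_mem hdiv (pow_mem hc (n μ).natAbs)) fun v hv => ?_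
      have hfv : f v = 0 := hvanish (d := -2) (by simpa using h2') (by omega) (hneg hv)
      have := pow_mul_pow_apply_of_primitive (e := f) (f := e) (h := -h) (m := (n μ).natAbs)
        (by rw [← hef]; abel)
        (by rw [neg_smul, ← hhe, neg_mul, mul_neg]; abel)
        (by rw [LinearMap.neg_apply, hweight v hv]; nth_rewrite 1 [h1]; simp) hfv
      rw [Module.End.mul_apply, dividedPow, LinearMap.smul_apply, smul_pow,
        LinearMap.smul_apply, map_smul, this, smul_smul, smul_smul, ← hsmul]
      congr 1
      ring

/-- For odd `α`, the supercommutator of `c X_α` with a suitable odd `X_β` is `± c X_{α+β}` with `α +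
β` even, so the even case applies to the same scalar. -/
theorem mem_binomRing_of_smul [FiniteDimensional K V] (ha₀ : a ≠ 0) (ha₁ : a ≠ -1)
    (hfaithful : Function.Injective ρ.toHom) (hρ : IsRational B ρ) (hM : IsAdmissible B ρ M)
    {α : roots a} {c : K} (hc : c • ρ.toHom (B.X α) ∈ latticeEnd M) : c ∈ binomRing a := by
  rcases α.2 with hα | hα
  · exact mem_binomRing_of_smul_even ha₀ ha₁ hfaithful hρ hM hα hc
  obtain ⟨β, hβ, hαβ, hval⟩ := exists_oddRoot_add_mem_evenRoots hα
  let β' : roots a := ⟨β, Or.inr hβ⟩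
  let δ : roots a := ⟨α.1 + β, Or.inl hαβ⟩
  have hbr := B.bracket_X_X' α β' δ hαβ.1 rfl (form_self_of_mem_oddRoots hα)
    (form_self_of_mem_oddRoots hβ)
  have hmem : c • ρ.toHom (bracket a (B.X α) (B.X β')) ∈ latticeEnd M := by
    rw [toHom_bracket_odd ρ (B.X_mem_part_one hα) (B.X_mem_part_one (α := β') hβ), smul_add,
      ← smul_mul_assoc, ← mul_smul_comm]
    have hβM := hM.toHom_X_mem β'
    exact add_mem (mul_mem hc hβM) (mul_mem hβM hc)
  have hval' : β'.1 (coroot a α.1) = -1 := hval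
  refine mem_binomRing_of_smul_even ha₀ ha₁ hfaithful hρ hM (α := δ) hαβ ?_
  rw [hval'] at hbr
  rcases hbr with h | h
  · simpa [h] using neg_mem hmem
  · simpa [h] using hmem

end Lattice

end D21

namespace D21

section Main

variable {K : Type*} [Field K] [CharZero K] {a : K} {V : Type*} [AddCommGroup V] [Module K V]
  {ρ : LieSuperalgebra.Rep (algebra a) V} {B : ChevalleyBasis a}

/-! ### The lattice `h_V` -/

omit [CharZero K] in
theorem finrank_cartan (B : ChevalleyBasis a) : Module.finrank K (cartan K) = 3 := by
  have hli : LinearIndependent K B.H := by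
    refine LinearIndependent.of_comp (cartan K).subtype ?_
    exact (linearIndependent_sum.1 B.linearIndependent).1
  simpa using Module.finrank_eq_card_basis (Module.Basis.mk hli B.span_H.ge)

/-- An element of `𝔥` on which all weights vanish acts by zero on `V`, so it is zero by
faithfulness; duality turns this into spanning. -/
theorem span_weights_eq_top (hfaithful : Function.Injective ρ.toHom)
    (hρ : ⨆ μ, weightSpace ρ μ = ⊤) : Submodule.span K (weights ρ) = ⊤ := by
  have hco : (Submodule.span K (weights ρ)).dualCoannihilator = ⊥ := by
    rw [Submodule.eq_bot_iff]
    intro H hH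
    by_contra h0
    obtain ⟨μ, hμ, hne⟩ := exists_weight_apply_ne_zero hfaithful hρ h0
    exact hne ((Submodule.mem_dualCoannihilator H).1 hH μ (Submodule.subset_span hμ))
  rw [← Subspace.dualCoannihilator_dualAnnihilator_eq (W := Submodule.span K (weights ρ)), hco,
    Submodule.dualAnnihilator_bot]

/-- A basis of `h` such that, for every subring `R`, its `R`-span is the set of the elements on
which all weights take values in `R`. -/
theorem exists_basis_dual_to_weights (ha₀ : a ≠ 0) (ha₁ : a ≠ -1)
    (hfaithful : Function.Injective ρ.toHom) (hρ : IsRational B ρ) :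
    ∃ d : Module.Basis (Fin 3) K (cartan K), ∀ R : Subring K,
      (∀ i, ∀ μ ∈ weights ρ, μ (d i) ∈ R) ∧
        ∀ H, (∀ μ ∈ weights ρ, μ H ∈ R) → ∀ i, d.repr H i ∈ R := by
  let wtZ : (Fin 3 → ℤ) →+ Module.Dual K (cartan K) :=
    { toFun := fun c => wt fun i => (c i : K)
      map_zero' := dual_ext fun i => by simp [wt_diagH]
      map_add' := fun c d => by rw [wt_add]; congr 1; funext i; simp }
  -- The subgroup generated by the weights, seen in `ℤ³` through their values on the `H_{2ε_i}`; as
  -- a subgroup of `ℤ³` it is free of rank at most `3`.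
  let N : Submodule ℤ (Fin 3 → ℤ) :=
    (Submodule.span ℤ (weights ρ)).comap wtZ.toIntLinearMap
  obtain ⟨n, ⟨c⟩⟩ := Submodule.nonempty_basis_of_pid (Pi.basisFun ℤ (Fin 3)) N
  have hn3 : n ≤ 3 := by
    have h := Submodule.finrank_le N
    rwa [Module.finrank_eq_card_basis c, Module.finrank_eq_card_basis (Pi.basisFun ℤ (Fin 3)),
      Fintype.card_fin, Fintype.card_fin] at h
  let b : Fin n → Module.Dual K (cartan K) := fun j => wtZ (c j)
  have hbmem : ∀ j, b j ∈ Submodule.span ℤ (weights ρ) := fun j => (c j).2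
  have hcomb : ∀ μ ∈ weights ρ, ∃ z : Fin n → ℤ, μ = ∑ j, z j • b j := by
    intro μ hμ
    choose m hm using fun i => exists_int_apply_diagH ha₀ ha₁ hρ hμ i
    have hμm : μ = wtZ m := dual_ext fun i => by simp [wtZ, wt_diagH, hm]
    have hmN : m ∈ N := by
      change wtZ m ∈ Submodule.span ℤ (weights ρ)
      exact hμm ▸ Submodule.subset_span hμ
    refine ⟨c.repr ⟨m, hmN⟩, ?_⟩
    have h := congrArg (fun x : N => wtZ x.1) (c.sum_repr ⟨m, hmN⟩)
    simp only [AddSubmonoidClass.coe_finsetSum, SetLike.val_smul, map_sum, map_zsmul] at h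
    rw [hμm, ← h]
  have hspan : ⊤ ≤ Submodule.span K (Set.range b) := by
    rw [← span_weights_eq_top hfaithful hρ.iSup_weightSpace, Submodule.span_le]
    intro μ hμ
    obtain ⟨z, rfl⟩ := hcomb μ hμ
    exact sum_mem fun j _ => zsmul_mem (Submodule.subset_span (Set.mem_range_self j)) _
  have hfin : FiniteDimensional K (cartan K) :=
    Module.finite_of_finrank_pos (by rw [finrank_cartan B]; norm_num)
  have hrank : Module.finrank K (Module.Dual K (cartan K)) = 3 := by
    rw [Subspace.dual_finrank_eq, finrank_cartan B]
  -- The weights span the three-dimensional `𝔥*` over `K`, so the rank is exactly `3` and the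
  -- `ℤ`-basis `b` is also a `K`-basis.
  have h3n := finrank_le_of_span_eq_top (top_le_iff.1 hspan)
  rw [hrank, Fintype.card_fin] at h3n
  obtain rfl : n = 3 := le_antisymm hn3 h3n
  let bK := basisOfTopLeSpanOfCardEqFinrank b hspan (by rw [hrank, Fintype.card_fin])
  have hbK : ∀ j, bK j = b j := fun j => by simp [bK]
  let d := bK.dualBasis.map (Module.evalEquiv K (cartan K)).symm
  have hd : ∀ i j, b i (d j) = if i = j then 1 else 0 := by
    intro i j
    rw [Module.Basis.map_apply, Module.apply_evalEquiv_symm_apply, ← hbK,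
      Module.Basis.dualBasis_apply_self]
  have hrepr : ∀ H i, d.repr H i = b i H := by
    intro H i
    conv_rhs => rw [← d.sum_repr H, map_sum]
    simp [hd]
  refine ⟨d, fun R => ⟨?_, ?_⟩⟩
  · intro i μ hμ
    obtain ⟨z, rfl⟩ := hcomb μ hμ
    rw [LinearMap.sum_apply]
    refine sum_mem fun j _ => ?_
    rw [LinearMap.smul_apply, hd]
    refine zsmul_mem ?_ _
    split_ifs
    exacts [R.one_mem, R.zero_mem]
  -- The coordinates of `H` are its values under `b i`, and each `b i` is an integral combination of
  -- weights.
  · intro H hH i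
    rw [hrepr]
    have h := hbmem i
    generalize b i = μ at h
    induction h using Submodule.span_induction with
    | mem μ hμ => exact hH μ hμ
    | zero => simp
    | add x y _ _ hx hy => exact add_mem hx hy
    | smul z x _ hx => exact zsmul_mem hx z

theorem cartanStabilizer_eq_span {d : Module.Basis (Fin 3) K (cartan K)}
    (h₁ : ∀ i, ∀ μ ∈ weights ρ, μ (d i) ∈ binomRing a)
    (h₂ : ∀ H, (∀ μ ∈ weights ρ, μ H ∈ binomRing a) → ∀ i, d.repr H i ∈ binomRing a) :
    cartanStabilizer ρ =
      Submodule.span (binomRing a) (Set.range fun i => (d i : Carrier K)) := by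
  apply le_antisymm
  · rintro _ ⟨H, rfl, hH⟩
    have h : (H : Carrier K) = ∑ i, (⟨d.repr H i, h₂ H hH i⟩ : binomRing a) • (d i : Carrier K) := by
      conv_lhs => rw [← d.sum_repr H, Submodule.coe_sum]
      rfl
    rw [h]
    exact sum_mem fun i _ => Submodule.smul_mem _ _ (Submodule.subset_span ⟨i, rfl⟩)
  · rw [Submodule.span_le]
    rintro _ ⟨i, rfl⟩
    exact ⟨d i, rfl, h₁ i⟩

/-! ### The stabilizer of an admissible lattice -/

/-- The `K`-basis of `D(2,1;a)` underlying a Chevalley basis. -/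
def ChevalleyBasis.basis (B : ChevalleyBasis a) : Module.Basis (Fin 3 ⊕ roots a) K (Carrier K) :=
  Module.Basis.mk B.linearIndependent B.span_eq_top.ge

omit [CharZero K] in
theorem ChevalleyBasis.basis_inl (B : ChevalleyBasis a) (i : Fin 3) :
    B.basis (Sum.inl i) = B.H i := by simp [ChevalleyBasis.basis]

omit [CharZero K] in
theorem ChevalleyBasis.basis_inr (B : ChevalleyBasis a) (α : roots a) :
    B.basis (Sum.inr α) = B.X α := by simp [ChevalleyBasis.basis]

omit [CharZero K] in
theorem ChevalleyBasis.repr_cartan (B : ChevalleyBasis a) (H : cartan K) (α : roots a) :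
    B.basis.repr (H : Carrier K) (Sum.inr α) = 0 := by
  have hH : H ∈ Submodule.span K (Set.range B.H) := B.span_H ▸ Submodule.mem_top
  induction hH using Submodule.span_induction with
  | mem x hx =>
    obtain ⟨i, rfl⟩ := hx
    rw [← B.basis_inl, B.basis.repr_self, Finsupp.single_eq_of_ne (by simp)]
  | zero => simp
  | add x y _ _ hx hy => simp [hx, hy]
  | smul c x _ hx => simp [hx]

-- The root vectors form part of a basis of a finite dimensional space.
omit [CharZero K] in
theorem finite_roots (B : ChevalleyBasis a) : Finite (roots a) :=
  have := Module.Finite.finite_basis B.basis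
  Finite.of_injective (Sum.inr : roots a → Fin 3 ⊕ roots a) Sum.inr_injective

/-- Directness is read off from coordinates in the `K`-basis of `B`: Cartan elements have no
`X_α`-coordinate, and multiples of `X_β` have no other coordinate. -/
theorem iSupIndep_cartanStabilizer_span (B : ChevalleyBasis a)
    (ρ : LieSuperalgebra.Rep (algebra a) V) :
    iSupIndep (fun i : Option (roots a) =>
      i.elim (cartanStabilizer ρ) fun α => Submodule.span (binomRing a) {B.X α}) := by
  intro i
  rw [Submodule.disjoint_def]
  have hker : ∀ j, ∃ S : Submodule (binomRing a) (Carrier K),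
      ∀ x, x ∈ S ↔ B.basis.repr x j = 0 := fun j =>
    ⟨(LinearMap.ker (B.basis.coord j)).restrictScalars (binomRing a), fun x => by simp⟩
  choose S hS using hker
  have hX : ∀ (β : roots a) (x), x ∈ Submodule.span (binomRing a) {B.X β} →
      ∀ j, j ≠ Sum.inr β → B.basis.repr x j = 0 := by
    intro β x hx j hj
    obtain ⟨r, rfl⟩ := Submodule.mem_span_singleton.1 hx
    rw [Subring.smul_def, map_smul, ← B.basis_inr, B.basis.repr_self, Finsupp.smul_apply,
      Finsupp.single_eq_of_ne hj, smul_zero]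
  cases i with
  | none =>
    rintro _ ⟨H, rfl, -⟩ hx
    refine B.basis.repr.map_eq_zero_iff.1 (Finsupp.ext fun j => ?_)
    rcases j with j | α
    · have hle : (⨆ (i : Option (roots a)) (_ : i ≠ none),
          i.elim (cartanStabilizer ρ) fun α => Submodule.span (binomRing a) {B.X α}) ≤
            S (Sum.inl j) := by
        refine iSup₂_le fun i hi => ?_
        cases i with
        | none => exact absurd rfl hi
        | some β => exact fun x hx => (hS _ x).2 (hX β x hx _ (by simp))
      exact (hS _ _).1 (hle hx)
    · exact B.repr_cartan H α
  | some α =>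
    intro x hx hx'
    have hle : (⨆ (i : Option (roots a)) (_ : i ≠ some α),
        i.elim (cartanStabilizer ρ) fun α => Submodule.span (binomRing a) {B.X α}) ≤
          S (Sum.inr α) := by
      refine iSup₂_le fun i hi => ?_
      cases i with
      | none =>
        rintro _ ⟨H, rfl, -⟩
        exact (hS _ _).2 (B.repr_cartan H α)
      | some β =>
        refine fun x hx => (hS _ x).2 (hX β x hx _ fun h => hi ?_)
        rw [Sum.inr.inj h]
    refine B.basis.repr.map_eq_zero_iff.1 (Finsupp.ext fun j => ?_)
    by_cases hj : j = Sum.inr α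
    · subst hj
      exact (hS _ _).1 (hle hx')
    · exact hX α x hx j hj

variable {M : Submodule (binomRing a) V}

/-- For one inclusion, `x` is split into components of distinct weight shift and each is treated
separately. For the other, `X_α` acts through the Kostant superalgebra, and `H` acts as a
`ℤ_a`-combination of weight projections. -/
theorem stabilizer_eq [FiniteDimensional K V] (ha₀ : a ≠ 0) (ha₁ : a ≠ -1)
    (hfaithful : Function.Injective ρ.toHom) (hρ : IsRational B ρ) (hM : IsAdmissible B ρ M) :
    ρ.stabilizer M = cartanStabilizer ρ ⊔
      ⨆ α : roots a, Submodule.span (binomRing a) {B.X α} := by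
  apply le_antisymm
  · intro x hx
    have hxM : ρ.toHom x ∈ latticeEnd M := hx
    have := finite_roots B
    cases nonempty_fintype (roots a)
    let H : cartan K := ∑ i, B.basis.repr x (Sum.inl i) • B.H i
    let c : roots a → K := fun α => B.basis.repr x (Sum.inr α)
    have hdec : x = H + ∑ α, c α • B.X α := by
      conv_lhs => rw [← B.basis.sum_repr x, Fintype.sum_sum_type]
      simp [H, c, B.basis_inl, B.basis_inr]
    let Z : Option (roots a) → Module.End K V := fun i =>
      i.elim (ρ.toHom (H : Carrier K)) fun α => c α • ρ.toHom (B.X α)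
    -- `none` indexes the Cartan part, of shift `0`; roots are nonzero, so all shifts are distinct.
    let β : Option (roots a) → Module.Dual K (cartan K) := fun i => i.elim 0 Subtype.val
    have hβ : Function.Injective β := by
      rintro (_ | α) (_ | α') h
      · rfl
      · exact absurd h.symm (ne_zero_of_mem_roots α'.2)
      · exact absurd h (ne_zero_of_mem_roots α.2)
      · exact congrArg some (Subtype.ext h)
    have hZ : ∀ i μ, ∀ v ∈ weightSpace ρ μ, Z i v ∈ weightSpace ρ (μ + β i) := by
      rintro (_ | α) μ v hv
      · change ρ.toHom (H : Carrier K) v ∈ weightSpace ρ (μ + 0)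
        rw [add_zero, (mem_weightSpace ρ μ v).1 hv]
        exact Submodule.smul_mem _ _ hv
      · obtain ⟨j, hj⟩ := B.homogeneous α
        exact Submodule.smul_mem _ _
          (toHom_mem_weightSpace ρ (B.X_mem_rootSpace α) hj hv)
    have hsum : ∑ i, Z i = ρ.toHom x := by
      rw [Fintype.sum_option, hdec]
      simp [Z]
    have hcomp := component_mem_latticeEnd ha₀ ha₁ hρ hM hβ hZ (hsum ▸ hxM)
    rw [hdec]
    refine Submodule.add_mem_sup ⟨H, rfl, ?_⟩ (sum_mem fun α _ => ?_)
    · exact (toHom_cartan_mem_latticeEnd_iff ha₀ ha₁ hρ hM H).1 (hcomp none)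
    · have hc := mem_binomRing_of_smul ha₀ ha₁ hfaithful hρ hM (hcomp (some α))
      exact Submodule.mem_iSup_of_mem α
        (Submodule.smul_mem _ (⟨c α, hc⟩ : binomRing a) (Submodule.mem_span_singleton_self _))
  · refine sup_le ?_ (iSup_le fun α => ?_)
    · rintro _ ⟨H, rfl, hH⟩
      exact (toHom_cartan_mem_latticeEnd_iff ha₀ ha₁ hρ hM H).2 hH
    · rw [Submodule.span_singleton_le_iff_mem]
      exact hM.toHom_X_mem α

/-- Replacing `H₁, H₂, H₃` in the Chevalley basis by the basis dual to the weights does not change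
the `K`-span of the Cartan part, so the result is still a `K`-basis of `𝔤`. -/
theorem isLatticeOver_cartanStabilizer_sup (ha₀ : a ≠ 0) (ha₁ : a ≠ -1)
    (hfaithful : Function.Injective ρ.toHom) (hρ : IsRational B ρ) :
    IsLatticeOver (binomRing a) (cartanStabilizer ρ ⊔
      ⨆ α : roots a, Submodule.span (binomRing a) {B.X α}) := by
  obtain ⟨d, hd⟩ := exists_basis_dual_to_weights ha₀ ha₁ hfaithful hρ
  obtain ⟨h₁, h₂⟩ := hd (binomRing a)
  have hmap : Submodule.span K (Set.range fun i => (d i : Carrier K)) =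
      Submodule.span K (Set.range fun i => (B.H i : Carrier K)) := by
    have h : ∀ f : Fin 3 → cartan K, Submodule.span K (Set.range fun i => (f i : Carrier K)) =
        (Submodule.span K (Set.range f)).map (cartan K).subtype := fun f => by
      rw [Submodule.map_span, ← Set.range_comp]
      rfl
    rw [h, h, d.span_eq, B.span_H]
  obtain ⟨-, hX, hdisj⟩ := linearIndependent_sum.1 B.linearIndependent
  refine ⟨Set.range (Sum.elim (fun i => (d i : Carrier K)) B.X), ?_, ?_, ?_⟩
  · refine LinearIndependent.linearIndepOn_id (LinearIndependent.sum_type ?_ hX ?_)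
    · exact d.linearIndependent.map' (cartan K).subtype (Submodule.ker_subtype _)
    · rw [hmap]
      exact hdisj
  · have h := B.span_eq_top
    rw [Set.Sum.elim_range, Submodule.span_union] at h ⊢
    rw [hmap, h]
  · rw [cartanStabilizer_eq_span h₁ h₂, Set.Sum.elim_range, Submodule.span_union,
      Submodule.span_range_eq_iSup (v := B.X)]

end Main

end D21
end

theorem mainTheorem9 {K : Type*} [Field K] [IsAlgClosed K] [CharZero K] (a : K)
    (ha₀ : a ≠ 0) (ha₁ : a ≠ -1) (B : D21.ChevalleyBasis a)
    {V : Type*} [AddCommGroup V] [Module K V] [FiniteDimensional K V]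
    (ρ : LieSuperalgebra.Rep (D21.algebra a) V) (hfaithful : Function.Injective ρ.toHom)
    (hrational : D21.IsRational B ρ)
    (M : Submodule (D21.binomRing a) V) (hM : D21.IsAdmissible B ρ M) :
    (ρ.stabilizer M = D21.cartanStabilizer ρ ⊔
        (⨆ α : D21.roots a, Submodule.span (D21.binomRing a) {B.X α}) ∧
      iSupIndep (fun i : Option (D21.roots a) =>
        i.elim (D21.cartanStabilizer ρ) fun α => Submodule.span (D21.binomRing a) {B.X α})) ∧
    IsLatticeOver (D21.binomRing a) (ρ.stabilizer M) ∧
    ∀ M' : Submodule (D21.binomRing a) V, D21.IsAdmissible B ρ M' →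
      ρ.stabilizer M' = ρ.stabilizer M := by
  have h : ∀ M' : Submodule (D21.binomRing a) V, D21.IsAdmissible B ρ M' →
      ρ.stabilizer M' = D21.cartanStabilizer ρ ⊔
        (⨆ α : D21.roots a, Submodule.span (D21.binomRing a) {B.X α}) := fun M' hM' =>
    D21.stabilizer_eq ha₀ ha₁ hfaithful hrational hM'
  refine ⟨⟨h M hM, D21.iSupIndep_cartanStabilizer_span B ρ⟩, ?_, fun M' hM' => ?_⟩
  · rw [h M hM]
    exact D21.isLatticeOver_cartanStabilizer_sup ha₀ ha₁ hfaithful hrational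
  · rw [h M' hM', h M hM]
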